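/- Let $n\ge 1$ and $N=2^n$, let $|0\rangle,\dots,|N-1\rangle$ be the computational basis of the $n$-qubit space $(\mathbb C^2)^{\otimes n}$ (labelled by binary expansion), and let $S=(-i\sigma^y_1)(-i\sigma^y_2)\cdots(-i\sigma^y_n)$, where $\sigma^y_l$ is the Pauli matrix $\sigma^y=\begin{pmatrix}0&-i\\ i&0\end{pmatrix}$ acting on the $l$-th qubit. For $X\in\mathfrak{su}(N)$ (the traceless skew-Hermitian $N\times N$ matrices) put $\theta(X)=S^{-1}\bar X S$, where $\bar X$ is the entrywise complex conjugate. Let $\mathfrak k$ and $\mathfrak p$ be the $+1$- and $-1$-eigenspaces of $\theta$ on $\mathfrak{su}(N)$. Let $$\mathcal D=\{\, i|j\rangle\langle j|+i|N-j-1\rangle\langle N-j-1|-i|j+1\rangle\langle j+1|-i|N-j-2\rangle\langle N-j-2| \;:\; 0\le j\le 2^{n-1}-2\,\},$$ $$\mathcal E=\{\, i|j\rangle\langle N-j-1|+i|N-j-1\rangle\langle j| \;:\; 0\le j\le 2^{n-1}-1\,\},$$ and let $\mathfrak a=\mathrm{span}_{\mathbb R}(\mathcal D\cup\mathcal E)$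 if $n$ is even and $\mathfrak a=\mathrm{span}_{\mathbb R}(\mathcal D)$ if $n$ is odd. Put $K=\exp\mathfrak k=\{e^X : X\in\mathfrak k\}$ and $A=\exp\mathfrak a=\{e^X : X\in\mathfrak a\}$. Then, for $n$ even as well as for $n$ odd: 1. $S$ is invertible, $S^{-1}\bar XS=(-1)^nS\bar XS$ for every complex $N\times N$ matrix $X$, and $\theta$ maps $\mathfrak{su}(N)$ into itself. It is a Cartan involution: $\theta^2=\mathbf 1$ and $\theta[X,Y]=[\theta X,\theta Y]$ for all $X,Y\in\mathfrak{su}(N)$. In particular $\mathfrak{su}(N)=\mathfrak k\oplus\mathfrak p$. 2. $\mathfrak a\subset\mathfrak p$, $\mathfrak a$ is commutative, and $\mathfrak a$ is maximal commutative in $\mathfrak p$: if $\mathfrak b$ is a real subspace with $\mathfrak a\subseteq\mathfrak b\subseteq\mathfrak p$ and $[X,Y]=0$ for all $X,Y\in\mathfrak b$, then $\mathfrak b=\mathfrak a$. 3. $SU(N)=KAK=\{k_1ak_2 : k_1,k_2\in K,\ a\in A\}$. -/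

import Mathlib

open scoped Pointwise

namespace CCD

/-- Matrices of linear operators on the `n`-qubit state space, in the computational basis
`|0⟩, …, |2^n - 1⟩`. -/
abbrev Op (n : ℕ) : Type := Matrix (Fin (2 ^ n)) (Fin (2 ^ n)) ℂ

/-- The state (`0` or `1`) of qubit `l` in the computational basis state `|j⟩`. Qubit `0` carries the
most significant binary digit of `j`, so that for three qubits `|5⟩ = |101⟩`. -/
def qubit {n : ℕ} (l : Fin n) (j : Fin (2 ^ n)) : Fin 2 := finFunctionFinEquiv.symm j l.rev

/-- The operator acting by the one-qubit matrix `M` on qubit `l`, and as the identity elsewhere. -/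
def onQubit {n : ℕ} (l : Fin n) (M : Matrix (Fin 2) (Fin 2) ℂ) : Op n :=
  Matrix.of fun a b =>
    if ∀ m, m ≠ l → qubit m a = qubit m b then M (qubit l a) (qubit l b) else 0

/-- The Pauli matrix `σ^y`. -/
def sigmaY : Matrix (Fin 2) (Fin 2) ℂ := !![0, -Complex.I; Complex.I, 0]

/-- `S = (-i σ^y_1) (-i σ^y_2) ⋯ (-i σ^y_n)`. -/
noncomputable def S (n : ℕ) : Op n :=
  (List.ofFn fun l : Fin n => onQubit l (-Complex.I • sigmaY)).prod

/-- The formula `X ↦ S⁻¹ X̄ S`, as a real-linear map on all matrices. -/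
noncomputable def theta (n : ℕ) : Op n →ₗ[ℝ] Op n where
  toFun X := (S n)⁻¹ * X.map (starRingEnd ℂ) * S n
  map_add' X Y := by
    rw [Matrix.map_add _ (map_add _), mul_add, add_mul]
  map_smul' r X := by
    have h : (r • X).map (starRingEnd ℂ) = r • X.map (starRingEnd ℂ) := by
      ext a b; simp
    rw [h]; simp

/-- `su(2^n)`: the traceless skew-Hermitian matrices, as a real vector space. -/
noncomputable def su (n : ℕ) : Submodule ℝ (Op n) :=
  skewAdjoint.submodule ℝ (Op n) ⊓ LinearMap.ker (Matrix.traceLinearMap (Fin (2 ^ n)) ℝ ℂ)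

/-- The `+1`-eigenspace of `theta` on `su(2^n)`. -/
noncomputable def frakK (n : ℕ) : Submodule ℝ (Op n) :=
  su n ⊓ Module.End.eigenspace (theta n) (1 : ℝ)

/-- The `-1`-eigenspace of `theta` on `su(2^n)`. -/
noncomputable def frakP (n : ℕ) : Submodule ℝ (Op n) :=
  su n ⊓ Module.End.eigenspace (theta n) (-1 : ℝ)

/-- The matrices `i|j⟩⟨j| + i|N-j-1⟩⟨N-j-1| - i|j+1⟩⟨j+1| - i|N-j-2⟩⟨N-j-2|` for
`0 ≤ j ≤ 2^(n-1) - 2`, where `N = 2^n`. Here `k = j + 1`, and `Fin.rev j` is `N - j - 1`. -/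
def diagGens (n : ℕ) : Set (Op n) :=
  {X | ∃ j k : Fin (2 ^ n), (k : ℕ) = (j : ℕ) + 1 ∧ (k : ℕ) < 2 ^ (n - 1) ∧
    X = Matrix.single j j Complex.I + Matrix.single j.rev j.rev Complex.I
      - Matrix.single k k Complex.I - Matrix.single k.rev k.rev Complex.I}

/-- The matrices `i|j⟩⟨N-j-1| + i|N-j-1⟩⟨j|` for `0 ≤ j ≤ 2^(n-1) - 1`, where `N = 2^n`. -/
def antidiagGens (n : ℕ) : Set (Op n) :=
  {X | ∃ j : Fin (2 ^ n), (j : ℕ) < 2 ^ (n - 1) ∧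
    X = Matrix.single j j.rev Complex.I + Matrix.single j.rev j Complex.I}

/-- The abelian algebra `𝔞`; the second generating set is used for even `n` only. -/
noncomputable def frakA (n : ℕ) : Submodule ℝ (Op n) :=
  if Even n then Submodule.span ℝ (diagGens n ∪ antidiagGens n)
  else Submodule.span ℝ (diagGens n)

/-- `K = exp 𝔨`. -/
noncomputable def K (n : ℕ) : Set (Op n) := NormedSpace.exp '' (frakK n : Set (Op n))

/-- `A = exp 𝔞`. -/
noncomputable def A (n : ℕ) : Set (Op n) := NormedSpace.exp '' (frakA n : Set (Op n))

end CCD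

/-!
`S` is a real signed permutation matrix with `S² = (-1)ⁿ`, so the antiunitary map `v ↦ S⁻¹ v̄`
(`conjS`) is a real structure for even `n` and a quaternionic structure for odd `n`, and `θ X = X` says
that `X` commutes with it. Both parities, types AI and AII of Cartan's list, are treated together, with
`tau X = S⁻¹ Xᵀ S` as the main tool: `θ X = tau Xᴴ`, and a skew-Hermitian `X` has `θ X = -X` exactly
when `tau X = X`.

*The group `K`* (`mem_K_iff`). `K` consists of all `θ`-fixed matrices of `SU(N)`. A logarithm of such
a matrix is assembled from pairs of eigenvectors `v ⟂ conjS v`, whose eigenvalues are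
conjugate (`exists_exp_eq_of_theta_eq`). Only the eigenvalue `-1` is delicate. There
`v ⟂ conjS v` is a quadratic equation in `v`, solvable in any two-dimensional space, and determinant
one provides the second dimension when no other eigenvalue can be used; for odd `n` the equation
holds identically.

*The subalgebra `𝔞`* (`mem_frakA_iff`). `𝔞` is the centralizer in `𝔭` of a single Hermitian matrix,
`regular n`. Since `i · regular n` lies in `𝔞` up to a scalar matrix, `𝔞` is maximal commutative.

*The decomposition* (`specialUnitaryGroup_subset`). For `U ∈ SU(N)` the matrix `M = U θ(U)⁻¹ = U tau U`
is unitary and `tau`-fixed. By compactness of `K`, a suitable `k ∈ K` conjugates the Cayley transform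
of `M`, hence `M` itself, into the centralizer of `regular n`: the derivative of a trace
function vanishes at its maximum on the orbit (`exists_conj_commute_regular`). There `kᴴ M k = e²` with
`e = exp Y` for an explicit `Y`, which is in `𝔞` except that its trace may not vanish. The
factor `eᴴ kᴴ U` is `θ`-fixed. Its determinant shows that the trace of `Y` can be removed without
changing `e²`, so that `U = k e (eᴴ kᴴ U)` is of the form required. For odd `n`, where diagonal
entries of `Y` come in pairs, this needs that `θ`-fixed unitary matrices have determinant one.
-/

namespace CCD

open Matrix NormedSpace

/-! ### The matrix `S` and the involution -/

/-- The matrix sending the basis vector `e_b` to `s b • e_(f b)`. -/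
def monomial {ι : Type*} [DecidableEq ι] (f : ι → ι) (s : ι → ℂ) : Matrix ι ι ℂ :=
  Matrix.of fun a b => if a = f b then s b else 0

lemma monomial_mul {ι : Type*} [Fintype ι] [DecidableEq ι] (f g : ι → ι) (s t : ι → ℂ) :
    monomial f s * monomial g t = monomial (f ∘ g) (fun b => s (g b) * t b) := by
  ext a b
  simp [monomial, Matrix.mul_apply]

/-- The basis label obtained from `b` by flipping the qubits in `L`. -/
def flipQubits {n : ℕ} (L : List (Fin n)) (b : Fin (2 ^ n)) : Fin (2 ^ n) :=
  finFunctionFinEquiv fun l => if l.rev ∈ L then (qubit l.rev b).rev else qubit l.rev b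

lemma qubit_flipQubits {n : ℕ} (L : List (Fin n)) (b : Fin (2 ^ n)) (l : Fin n) :
    qubit l (flipQubits L b) = if l ∈ L then (qubit l b).rev else qubit l b := by
  simp [qubit, flipQubits]

lemma eq_of_qubit_eq {n : ℕ} {a b : Fin (2 ^ n)} (h : ∀ l, qubit l a = qubit l b) : a = b := by
  apply finFunctionFinEquiv.symm.injective
  funext l
  simpa [qubit] using h l.rev

/-- `-i σ^y` maps `|q⟩` to `qubitSign q • |1 - q⟩`. -/
def qubitSign (q : Fin 2) : ℂ := if q = 0 then 1 else -1

lemma onQubit_eq_monomial {n : ℕ} (l : Fin n) :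
    onQubit l (-Complex.I • sigmaY) =
      monomial (flipQubits [l]) (fun b => qubitSign (qubit l b)) := by
  have h2 : ∀ p q : Fin 2, (-Complex.I • sigmaY) p q = if p = q.rev then qubitSign q else 0 := by
    intro p q
    fin_cases p <;> fin_cases q <;> simp [sigmaY, qubitSign]
  ext a b
  have key : a = flipQubits [l] b ↔
      (∀ m, m ≠ l → qubit m a = qubit m b) ∧ qubit l a = (qubit l b).rev := by
    constructor
    · rintro rfl
      refine ⟨fun m hm => ?_, ?_⟩ <;> rw [qubit_flipQubits] <;> simp [*]
    · rintro ⟨h, h'⟩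
      refine eq_of_qubit_eq fun m => ?_
      rw [qubit_flipQubits]
      by_cases hm : m = l
      · subst hm; simpa using h'
      · simpa [hm] using h m hm
  simp only [onQubit, monomial, Matrix.of_apply, h2, key, ite_and]

lemma prod_onQubit {n : ℕ} (L : List (Fin n)) (hL : L.Nodup) :
    (L.map fun l => onQubit l (-Complex.I • sigmaY)).prod =
      monomial (flipQubits L) (fun b => (L.map fun l => qubitSign (qubit l b)).prod) := by
  induction L with
  | nil =>
    ext a b
    have : flipQubits [] b = b := eq_of_qubit_eq fun l => by simp [qubit_flipQubits]
    simp [monomial, this, Matrix.one_apply]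
  | cons l L ih =>
    rw [List.nodup_cons] at hL
    rw [List.map_cons, List.prod_cons, ih hL.2, onQubit_eq_monomial, monomial_mul]
    have hf : flipQubits [l] ∘ flipQubits L = flipQubits (l :: L) := by
      funext b
      refine eq_of_qubit_eq fun m => ?_
      simp only [Function.comp, qubit_flipQubits, List.mem_cons]
      by_cases hm : m = l
      · subst hm; simp [hL.1]
      · simp [hm]
    rw [hf]
    congr 1
    funext b
    simp [qubit_flipQubits, hL.1]

lemma qubit_rev {n : ℕ} (l : Fin n) (b : Fin (2 ^ n)) : qubit l b.rev = (qubit l b).rev := by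
  have h : b.rev = finFunctionFinEquiv fun l => (finFunctionFinEquiv.symm b l).rev := by
    obtain ⟨f, rfl⟩ := finFunctionFinEquiv.surjective b
    ext
    rw [Equiv.symm_apply_apply, Fin.val_rev, finFunctionFinEquiv_apply, finFunctionFinEquiv_apply]
    -- The digits of `b` and of `N - 1 - b` add up to one in each place.
    have hs : (∑ i, ((f i : ℕ) * 2 ^ (i : ℕ))) + ∑ i, (((f i).rev : ℕ) * 2 ^ (i : ℕ)) + 1
        = 2 ^ n := by
      rw [← Finset.sum_add_distrib]
      have : ∀ i, (f i : ℕ) * 2 ^ (i : ℕ) + ((f i).rev : ℕ) * 2 ^ (i : ℕ) = 2 ^ (i : ℕ) := by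
        intro i
        rw [← add_mul, Fin.val_rev]
        have := (f i).isLt
        have h1 : (f i : ℕ) + (2 - (f i + 1)) = 1 := by omega
        rw [h1, one_mul]
      rw [Finset.sum_congr rfl fun i _ => this i, Fin.sum_univ_eq_sum_range (fun i => 2 ^ i) n,
        Nat.geomSum_eq le_rfl]
      have := Nat.one_le_two_pow (n := n)
      simp only [Nat.reduceSub, Nat.div_one]
      omega
    omega
  simp [qubit, h]

/-- `S` maps `|b⟩` to `signS b • |N - 1 - b⟩`: the sign counts the ones among the digits of `b`. -/
noncomputable def signS {n : ℕ} (b : Fin (2 ^ n)) : ℂ :=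
  ((List.finRange n).map fun l => qubitSign (qubit l b)).prod

lemma S_apply {n : ℕ} (a b : Fin (2 ^ n)) : S n a b = if a = b.rev then signS b else 0 := by
  have h : flipQubits (List.finRange n) b = b.rev :=
    eq_of_qubit_eq fun l => by simp [qubit_flipQubits, qubit_rev]
  rw [S, List.ofFn_eq_map, prod_onQubit _ (List.nodup_finRange n)]
  simp [monomial, h, signS]

lemma signS_rev {n : ℕ} (b : Fin (2 ^ n)) : signS b.rev = (-1) ^ n * signS b := by
  have h : ∀ q : Fin 2, qubitSign q.rev = (-1) * qubitSign q := by
    intro q; fin_cases q <;> simp [qubitSign]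
  simp only [signS, qubit_rev, h]
  rw [List.prod_map_mul]
  simp

lemma signS_eq {n : ℕ} (b : Fin (2 ^ n)) : signS b = 1 ∨ signS b = -1 := by
  unfold signS
  induction List.finRange n with
  | nil => simp
  | cons l L ih =>
    have : qubitSign (qubit l b) = 1 ∨ qubitSign (qubit l b) = -1 := by
      unfold qubitSign; split_ifs <;> simp
    rw [List.map_cons, List.prod_cons]
    rcases ih with h | h <;> rcases this with h' | h' <;> rw [h, h'] <;> simp

lemma signS_mul_self {n : ℕ} (b : Fin (2 ^ n)) : signS b * signS b = 1 := by
  rcases signS_eq b with h | h <;> rw [h] <;> norm_num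

lemma signS_ne_zero {n : ℕ} (b : Fin (2 ^ n)) : signS b ≠ 0 := by
  rcases signS_eq b with h | h <;> rw [h] <;> norm_num

lemma star_signS {n : ℕ} (b : Fin (2 ^ n)) : star (signS b) = signS b := by
  rcases signS_eq b with h | h <;> rw [h] <;> simp

lemma S_mul_apply {n : ℕ} (X : Op n) (a b : Fin (2 ^ n)) :
    (S n * X) a b = signS a.rev * X a.rev b := by
  rw [Matrix.mul_apply, Finset.sum_eq_single a.rev]
  · simp [S_apply]
  · intro c _ hc
    rw [S_apply, if_neg, zero_mul]
    rintro rfl; simp at hc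
  · simp

lemma mul_S_apply {n : ℕ} (X : Op n) (a b : Fin (2 ^ n)) :
    (X * S n) a b = X a b.rev * signS b := by
  rw [Matrix.mul_apply, Finset.sum_eq_single b.rev]
  · simp [S_apply]
  · intro c _ hc
    rw [S_apply, if_neg hc, mul_zero]
  · simp

lemma S_mul_S (n : ℕ) : S n * S n = (-1 : ℂ) ^ n • 1 := by
  ext a b
  rw [S_mul_apply, S_apply, signS_rev, Matrix.smul_apply, Matrix.one_apply]
  by_cases h : a = b
  · subst h
    simp [mul_assoc, signS_mul_self]
  · simp [h]

lemma neg_one_pow_smul_smul (n : ℕ) (X : Op n) : (-1 : ℂ) ^ n • (-1 : ℂ) ^ n • X = X := by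
  rw [smul_smul, ← mul_pow]; simp

lemma S_mul_smul_S (n : ℕ) : S n * ((-1 : ℂ) ^ n • S n) = 1 := by
  rw [Matrix.mul_smul, S_mul_S, neg_one_pow_smul_smul]

lemma isUnit_S (n : ℕ) : IsUnit (S n) :=
  IsUnit.of_mul_eq_one _ (S_mul_smul_S n)

lemma inv_S (n : ℕ) : (S n)⁻¹ = (-1 : ℂ) ^ n • S n :=
  Matrix.inv_eq_right_inv (S_mul_smul_S n)

lemma inv_S_mul_S (n : ℕ) : (S n)⁻¹ * S n = 1 :=
  Matrix.nonsing_inv_mul _ ((Matrix.isUnit_iff_isUnit_det _).1 (isUnit_S n))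

lemma S_mul_inv_S (n : ℕ) : S n * (S n)⁻¹ = 1 :=
  Matrix.mul_nonsing_inv _ ((Matrix.isUnit_iff_isUnit_det _).1 (isUnit_S n))

lemma transpose_S (n : ℕ) : (S n)ᵀ = (S n)⁻¹ := by
  ext a b
  rw [inv_S, Matrix.transpose_apply, Matrix.smul_apply, S_apply, S_apply, smul_eq_mul, mul_ite,
    mul_zero, ← signS_rev]
  by_cases h : b = a.rev
  · subst h; simp
  · rw [if_neg h, if_neg]
    rintro rfl; simp at h

lemma map_star_S (n : ℕ) : (S n).map (starRingEnd ℂ) = S n := by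
  ext a b
  rw [Matrix.map_apply, S_apply]
  split_ifs
  · exact star_signS b
  · simp

lemma conjTranspose_S (n : ℕ) : (S n)ᴴ = (S n)⁻¹ := by
  rw [← transpose_S]
  ext a b
  have := congrFun (congrFun (map_star_S n) b) a
  simpa using this

/-- The complex-linear anti-automorphism `X ↦ S⁻¹ Xᵀ S`. It is related to the involution by
`theta X = tau Xᴴ`. -/
noncomputable def tau (n : ℕ) (X : Op n) : Op n := (S n)⁻¹ * Xᵀ * S n

lemma theta_eq {n : ℕ} (X : Op n) : theta n X = tau n Xᴴ := by
  have : X.map (starRingEnd ℂ) = Xᴴᵀ := by ext; simp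
  simp [theta, tau, this]

lemma tau_mul {n : ℕ} (X Y : Op n) : tau n (X * Y) = tau n Y * tau n X := by
  simp only [tau, Matrix.transpose_mul]
  calc _ = (S n)⁻¹ * Yᵀ * 1 * Xᵀ * S n := by simp only [mul_assoc, one_mul]
    _ = _ := by rw [← S_mul_inv_S]; simp only [mul_assoc]

lemma tau_one (n : ℕ) : tau n 1 = 1 := by simp [tau, inv_S_mul_S]

lemma tau_add {n : ℕ} (X Y : Op n) : tau n (X + Y) = tau n X + tau n Y := by
  simp [tau, mul_add, add_mul]

lemma tau_smul {n : ℕ} (c : ℂ) (X : Op n) : tau n (c • X) = c • tau n X := by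
  simp [tau]

lemma tau_sub {n : ℕ} (X Y : Op n) : tau n (X - Y) = tau n X - tau n Y := by
  simp [tau, mul_sub, sub_mul]

lemma tau_neg {n : ℕ} (X : Op n) : tau n (-X) = -tau n X := by
  simp [tau]

lemma tau_tau {n : ℕ} (X : Op n) : tau n (tau n X) = X := by
  have h1 : (S n)⁻¹ᵀ = S n := by rw [← transpose_S, transpose_transpose]
  simp only [tau, Matrix.transpose_mul, transpose_transpose, h1]
  rw [transpose_S, inv_S]
  simp only [Matrix.smul_mul, Matrix.mul_smul]
  calc _ = (S n * S n) * X * (S n * S n) := by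
        rw [neg_one_pow_smul_smul]; simp only [mul_assoc]
    _ = X := by rw [S_mul_S]; simp [neg_one_pow_smul_smul]

lemma tau_conjTranspose {n : ℕ} (X : Op n) : (tau n X)ᴴ = tau n Xᴴ := by
  have h1 : (S n)⁻¹ᴴ = S n := by rw [← conjTranspose_S, conjTranspose_conjTranspose]
  have h2 : Xᵀᴴ = Xᴴᵀ := rfl
  rw [tau, tau, Matrix.conjTranspose_mul, Matrix.conjTranspose_mul, h1, h2, conjTranspose_S,
    mul_assoc]

lemma trace_tau {n : ℕ} (X : Op n) : (tau n X).trace = X.trace := by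
  rw [tau, Matrix.trace_mul_comm, ← mul_assoc, S_mul_inv_S, one_mul, Matrix.trace_transpose]

lemma det_tau {n : ℕ} (X : Op n) : (tau n X).det = X.det := by
  have h := congrArg det (S_mul_inv_S n)
  rw [det_mul, det_one] at h
  rw [tau, det_mul, det_mul, det_transpose]
  linear_combination X.det * h

lemma theta_theta {n : ℕ} (X : Op n) : theta n (theta n X) = X := by
  rw [theta_eq, theta_eq, tau_conjTranspose, tau_tau, conjTranspose_conjTranspose]

lemma theta_mul {n : ℕ} (X Y : Op n) : theta n (X * Y) = theta n X * theta n Y := by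
  simp only [theta_eq, conjTranspose_mul, tau_mul]

lemma theta_one (n : ℕ) : theta n 1 = 1 := by
  rw [theta_eq, conjTranspose_one, tau_one]

lemma theta_smul {n : ℕ} (c : ℂ) (X : Op n) : theta n (c • X) = star c • theta n X := by
  rw [theta_eq, conjTranspose_smul, tau_smul, theta_eq]

lemma theta_conjTranspose {n : ℕ} (X : Op n) : theta n Xᴴ = (theta n X)ᴴ := by
  rw [theta_eq, theta_eq, tau_conjTranspose]

lemma trace_theta {n : ℕ} (X : Op n) : (theta n X).trace = star X.trace := by
  rw [theta_eq, trace_tau, trace_conjTranspose]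

lemma tau_eq_conjTranspose {n : ℕ} {X : Op n} (hX : theta n X = X) : tau n X = Xᴴ := by
  conv_lhs => rw [← hX, theta_eq, tau_tau]

/-- The condition `tau X = X`, which is `Xᵀ S = S X`, in terms of matrix entries. -/
lemma tau_eq_self_iff {n : ℕ} (X : Op n) :
    tau n X = X ↔ ∀ a b, signS b * X b.rev a = signS a.rev * X a.rev b := by
  have h : tau n X = X ↔ Xᵀ * S n = S n * X := by
    constructor
    · intro h
      conv_rhs => rw [← h, tau, mul_assoc, ← mul_assoc, S_mul_inv_S, one_mul]
    · intro h
      rw [tau, mul_assoc, h, ← mul_assoc, inv_S_mul_S, one_mul]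
  rw [h, ← Matrix.ext_iff]
  simp only [mul_S_apply, S_mul_apply, transpose_apply, mul_comm]

lemma mem_su {n : ℕ} {X : Op n} : X ∈ su n ↔ Xᴴ = -X ∧ X.trace = 0 := by
  simp [su, skewAdjoint.submodule, skewAdjoint.mem_iff, Matrix.star_eq_conjTranspose]

lemma mem_frakK {n : ℕ} {X : Op n} : X ∈ frakK n ↔ X ∈ su n ∧ theta n X = X := by
  simp [frakK]

lemma mem_frakP {n : ℕ} {X : Op n} : X ∈ frakP n ↔ X ∈ su n ∧ theta n X = -X := by
  simp [frakP]

lemma theta_mem_su {n : ℕ} {X : Op n} (hX : X ∈ su n) : theta n X ∈ su n := by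
  rw [mem_su] at *
  rw [← theta_conjTranspose, hX.1, trace_theta, hX.2]
  simp

/-- The trace condition in `𝔨` is automatic. -/
lemma mem_frakK_of_skew {n : ℕ} {X : Op n} (h1 : Xᴴ = -X) (h2 : theta n X = X) :
    X ∈ frakK n := by
  refine mem_frakK.2 ⟨mem_su.2 ⟨h1, ?_⟩, h2⟩
  have ht := trace_theta X
  rw [h2] at ht
  have h3 := congrArg trace h1
  rw [trace_conjTranspose, ← ht, trace_neg] at h3
  linear_combination h3 / 2

lemma mem_frakP_iff {n : ℕ} {X : Op n} :
    X ∈ frakP n ↔ Xᴴ = -X ∧ X.trace = 0 ∧ tau n X = X := by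
  rw [mem_frakP, mem_su, and_assoc]
  refine and_congr_right fun h => and_congr_right fun _ => ?_
  rw [theta_eq, h, tau_neg, neg_inj]

lemma frakK_inf_frakP (n : ℕ) : frakK n ⊓ frakP n = ⊥ := by
  rw [eq_bot_iff]
  intro X hX
  have h1 := (mem_frakK.1 hX.1).2
  have h2 := (mem_frakP.1 hX.2).2
  rw [Submodule.mem_bot]
  have h3 : X + X = 0 := by
    nth_rewrite 1 [h1.symm.trans h2]
    simp
  have h4 : (2 : ℂ) • X = 0 := by rw [two_smul, h3]
  simpa using h4

lemma frakK_sup_frakP (n : ℕ) : frakK n ⊔ frakP n = su n := by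
  apply le_antisymm (sup_le inf_le_left inf_le_left)
  intro X hX
  have h : X = (1 / 2 : ℝ) • (X + theta n X) + (1 / 2 : ℝ) • (X - theta n X) := by
    rw [← smul_add]
    simp only [add_add_sub_cancel, smul_add, ← add_smul]
    norm_num
  rw [h]
  refine Submodule.add_mem_sup (mem_frakK.2 ⟨?_, ?_⟩) (mem_frakP.2 ⟨?_, ?_⟩)
  · exact (su n).smul_mem _ ((su n).add_mem hX (theta_mem_su hX))
  · rw [map_smul, map_add, theta_theta, add_comm]
  · exact (su n).smul_mem _ ((su n).sub_mem hX (theta_mem_su hX))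
  · rw [map_smul, map_sub, theta_theta, ← smul_neg, neg_sub]

lemma theta_lie {n : ℕ} (X Y : Op n) : theta n ⁅X, Y⁆ = ⁅theta n X, theta n Y⁆ := by
  rw [Ring.lie_def, Ring.lie_def, map_sub, theta_mul, theta_mul]

/-! ### Exponentials of matrices -/

section Exponential

attribute [local instance] Matrix.linftyOpNormedRing Matrix.linftyOpNormedAlgebra

lemma exp_mulVec_of_eigenvector {ι : Type*} [Fintype ι] [DecidableEq ι] {Y : Matrix ι ι ℂ}
    {v : ι → ℂ} {c : ℂ} (h : Y *ᵥ v = c • v) : exp Y *ᵥ v = Complex.exp c • v := by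
  have hp : ∀ k : ℕ, (Y ^ k) *ᵥ v = c ^ k • v := by
    intro k
    induction k with
    | zero => simp
    | succ k ih => rw [pow_succ, ← mulVec_mulVec, h, mulVec_smul, ih, smul_smul, pow_succ']
  let F : Matrix ι ι ℂ →ₗ[ℂ] (ι → ℂ) :=
    { toFun := fun A => A *ᵥ v
      map_add' := fun A B => add_mulVec A B v
      map_smul' := fun c A => smul_mulVec c A v }
  have hF : Continuous F := F.continuous_of_finiteDimensional
  have h1 := (exp_series_hasSum_exp' (𝕂 := ℂ) Y).map F hF
  have h2 := (exp_series_hasSum_exp' (𝕂 := ℂ) c).smul_const v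
  rw [← Complex.exp_eq_exp_ℂ] at h2
  refine h1.unique ?_
  convert! h2 using 2 with k
  simp [F, hp, smul_smul, smul_mulVec]

lemma theta_exp {n : ℕ} (X : Op n) : theta n (exp X) = exp (theta n X) := by
  let F : Op n →+* Op n :=
    { toFun := theta n
      map_one' := theta_one n
      map_mul' := theta_mul
      map_zero' := map_zero _
      map_add' := map_add _ }
  exact map_exp F (theta n).continuous_of_finiteDimensional X

lemma continuous_theta (n : ℕ) : Continuous (theta n) :=
  (theta n).continuous_of_finiteDimensional

end Exponential

/-- The identity `det (exp X) = e ^ tr X`, proved for skew-Hermitian `X` by diagonalizing `i X`. -/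
lemma det_exp_of_skew {ι : Type*} [Fintype ι] [DecidableEq ι] {X : Matrix ι ι ℂ}
    (h : Xᴴ = -X) : (exp X).det = Complex.exp X.trace := by
  have hH : (Complex.I • X).IsHermitian := by
    rw [Matrix.IsHermitian, conjTranspose_smul, h]; simp
  set V : Matrix ι ι ℂ := hH.eigenvectorUnitary.1 with hV
  have hVV : V * star V = 1 := Unitary.mul_star_self_of_mem hH.eigenvectorUnitary.2
  have hinv : V⁻¹ = star V := Matrix.inv_eq_right_inv hVV
  have hu : IsUnit V := IsUnit.of_mul_eq_one _ hVV
  set d : ι → ℂ := fun i => -Complex.I * hH.eigenvalues i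
  have hX : X = V * diagonal d * V⁻¹ := by
    have hs := hH.spectral_theorem
    rw [Unitary.conjStarAlgAut_apply] at hs
    have h1 : X = (-Complex.I) • (Complex.I • X) := by simp [smul_smul]
    have h2 : diagonal d = (-Complex.I) • diagonal (RCLike.ofReal ∘ hH.eigenvalues) := by
      ext i j; by_cases hij : i = j <;> simp [hij, d, diagonal]
    rw [h2, hinv, mul_smul_comm, smul_mul_assoc, ← hs, ← h1]
  have hdet : V.det * V⁻¹.det = 1 := by rw [← det_mul, hinv, hVV, det_one]
  have htr : X.trace = ∑ i, d i := by
    rw [hX, trace_mul_comm, ← mul_assoc, hinv, mul_eq_one_comm.1 hVV, one_mul, trace_diagonal]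
  rw [htr, hX, exp_conj _ _ hu, exp_diagonal, det_mul, det_mul, det_diagonal, Complex.exp_sum]
  have : ∀ i, exp d i = Complex.exp (d i) := fun i => by
    rw [Pi.coe_exp, Complex.exp_eq_exp_ℂ]
  simp only [this]
  linear_combination (∏ i, Complex.exp (d i)) * hdet

lemma exp_mem_unitaryGroup {ι : Type*} [Fintype ι] [DecidableEq ι] {X : Matrix ι ι ℂ}
    (h : Xᴴ = -X) : exp X ∈ unitaryGroup ι ℂ := by
  rw [mem_unitaryGroup_iff, star_eq_conjTranspose, ← exp_conjTranspose, h,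
    ← exp_add_of_commute _ _ (Commute.neg_right (Commute.refl X)), add_neg_cancel, exp_zero]

lemma exp_mem_specialUnitaryGroup {n : ℕ} {X : Op n} (h : X ∈ su n) :
    exp X ∈ specialUnitaryGroup (Fin (2 ^ n)) ℂ := by
  rw [mem_su] at h
  rw [mem_specialUnitaryGroup_iff, det_exp_of_skew h.1, h.2, Complex.exp_zero]
  exact ⟨exp_mem_unitaryGroup h.1, rfl⟩

/-! ### Eigenvectors of unitary matrices and the antiunitary map -/

section UnitaryEigenvectors

open scoped ComplexOrder

variable {ι : Type*} [Fintype ι] [DecidableEq ι]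

lemma star_mulVec_dotProduct_mulVec {w : Matrix ι ι ℂ} (hw : w ∈ unitaryGroup ι ℂ) (u v : ι → ℂ) :
    star (w *ᵥ u) ⬝ᵥ (w *ᵥ v) = star u ⬝ᵥ v := by
  rw [mem_unitaryGroup_iff', star_eq_conjTranspose] at hw
  rw [star_mulVec, dotProduct_mulVec, vecMul_vecMul, hw, vecMul_one]

lemma star_eigenvalue_mul_self {w : Matrix ι ι ℂ} (hw : w ∈ unitaryGroup ι ℂ) {v : ι → ℂ} {c : ℂ}
    (hv : v ≠ 0) (h : w *ᵥ v = c • v) : star c * c = 1 := by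
  have h1 := star_mulVec_dotProduct_mulVec hw v v
  rw [h, star_smul, smul_dotProduct, dotProduct_smul, smul_smul, smul_eq_mul] at h1
  have h2 : star v ⬝ᵥ v ≠ 0 := by rwa [Ne, dotProduct_star_self_eq_zero]
  exact mul_right_cancel₀ h2 (by rw [h1, one_mul])

lemma dotProduct_eq_zero_of_eigenvalue_ne {w : Matrix ι ι ℂ} (hw : w ∈ unitaryGroup ι ℂ)
    {u v : ι → ℂ} {c d : ℂ} (hu : w *ᵥ u = c • u) (hv : w *ᵥ v = d • v) (hcd : c ≠ d) :
    star u ⬝ᵥ v = 0 := by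
  by_cases hu0 : u = 0
  · simp [hu0]
  have hc := star_eigenvalue_mul_self hw hu0 hu
  have h1 := star_mulVec_dotProduct_mulVec hw u v
  rw [hu, hv, star_smul, smul_dotProduct, dotProduct_smul, smul_smul, smul_eq_mul] at h1
  by_contra h0
  have h2 : star c * d = 1 := mul_right_cancel₀ h0 (by rw [h1, one_mul])
  have h3 : star c ≠ 0 := by rintro h; simp [h] at hc
  exact hcd (mul_left_cancel₀ h3 (hc.trans h2.symm))

/-- The range of `w - 1` is stable under `w`, and it is orthogonal to the fixed vectors of `w`, so
an eigenvector of `w` in it has an eigenvalue other than `1`. -/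
lemma exists_eigenvector_ne_one {w : Matrix ι ι ℂ} (hw : w ∈ unitaryGroup ι ℂ) (h1 : w ≠ 1) :
    ∃ (v : ι → ℂ) (c : ℂ), v ≠ 0 ∧ c ≠ 1 ∧ w *ᵥ v = c • v := by
  let p : Submodule ℂ (ι → ℂ) := LinearMap.range (mulVecLin (w - 1))
  have hp : ∀ x ∈ p, mulVecLin w x ∈ p := by
    rintro _ ⟨y, rfl⟩
    refine ⟨w *ᵥ y, ?_⟩
    simp only [mulVecLin_apply, mulVec_mulVec]
    rw [mul_sub, sub_mul, mul_one, one_mul]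
  have hne : p ≠ ⊥ := by
    intro h
    rw [LinearMap.range_eq_bot] at h
    apply h1
    rw [← sub_eq_zero]
    ext i j
    have := congrFun (LinearMap.congr_fun h (Pi.single j 1)) i
    simpa [one_apply, Pi.single_apply] using this
  have : Nontrivial p := Submodule.nontrivial_iff_ne_bot.2 hne
  obtain ⟨c, hc⟩ := Module.End.exists_eigenvalue ((mulVecLin w).restrict hp)
  obtain ⟨⟨v, hvp⟩, hv⟩ := hc.exists_hasEigenvector
  have hv0 : v ≠ 0 := fun h => hv.2 (by simp [h])
  have hwv : w *ᵥ v = c • v := by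
    have := congrArg Subtype.val hv.apply_eq_smul
    simpa using this
  refine ⟨v, c, hv0, ?_, hwv⟩
  rintro rfl
  obtain ⟨y, hy⟩ := hvp
  have hy' : w *ᵥ y = y + v := by
    rw [← hy, mulVecLin_apply, sub_mulVec, one_mulVec]; abel
  have h2 := star_mulVec_dotProduct_mulVec hw v y
  rw [hwv, one_smul, hy', dotProduct_add] at h2
  have h3 : star v ⬝ᵥ v = 0 := by linear_combination h2
  exact hv0 (dotProduct_star_self_eq_zero.1 h3)

end UnitaryEigenvectors

section Conjugation

open scoped ComplexOrder

variable {n : ℕ}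

/-- The antiunitary map `v ↦ S⁻¹ v̄`. A matrix is fixed by `theta` exactly when it commutes
with this map. -/
noncomputable def conjS (v : Fin (2 ^ n) → ℂ) : Fin (2 ^ n) → ℂ := (S n)⁻¹ *ᵥ star v

lemma star_conjS (v : Fin (2 ^ n) → ℂ) : star (conjS v) = v ᵥ* S n := by
  have h1 : (S n)⁻¹ᴴ = S n := by rw [← conjTranspose_S, conjTranspose_conjTranspose]
  rw [conjS, star_mulVec, star_star, h1]

lemma star_conjS_dotProduct_conjS (u v : Fin (2 ^ n) → ℂ) :
    star (conjS u) ⬝ᵥ conjS v = star v ⬝ᵥ u := by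
  rw [star_conjS, conjS, dotProduct_mulVec, vecMul_vecMul, S_mul_inv_S, vecMul_one,
    dotProduct_comm]

lemma conjS_smul (c : ℂ) (v : Fin (2 ^ n) → ℂ) : conjS (c • v) = star c • conjS v := by
  rw [conjS, star_smul, mulVec_smul, conjS]

lemma mulVec_conjS {w : Op n} (hw : theta n w = w) (v : Fin (2 ^ n) → ℂ) :
    w *ᵥ conjS v = conjS (w *ᵥ v) := by
  have h : w * (S n)⁻¹ = (S n)⁻¹ * wᴴᵀ := by
    conv_lhs => rw [← hw, theta_eq, tau, mul_assoc, S_mul_inv_S, mul_one]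
  rw [conjS, conjS, mulVec_mulVec, h, star_mulVec, ← mulVec_mulVec, mulVec_transpose]

lemma theta_vecMulVec (u v : Fin (2 ^ n) → ℂ) :
    theta n (vecMulVec u (star v)) = vecMulVec (conjS u) (star (conjS v)) := by
  have h : (vecMulVec u (star v))ᴴᵀ = vecMulVec (star u) v := by
    ext i j; simp [vecMulVec_apply, mul_comm]
  rw [theta_eq, tau, h, mul_vecMulVec, vecMulVec_mul, star_conjS, conjS]

/-- The skew-Hermitian matrix fixed by `theta` which acts as `c` on `v`, as `-c` on `conjS v`, and
as `0` on their orthogonal complement, provided that `c` is imaginary and `v ⟂ conjS v`. -/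
noncomputable def pairGen (c : ℂ) (v : Fin (2 ^ n) → ℂ) : Op n :=
  (c / (star v ⬝ᵥ v)) • (vecMulVec v (star v) - vecMulVec (conjS v) (star (conjS v)))

lemma star_dotProduct_self (v : Fin (2 ^ n) → ℂ) : star (star v ⬝ᵥ v) = star v ⬝ᵥ v := by
  rw [← star_dotProduct]

lemma conjTranspose_vecMulVec_self (v : Fin (2 ^ n) → ℂ) :
    (vecMulVec v (star v))ᴴ = vecMulVec v (star v) := by
  ext i j; simp [vecMulVec_apply, mul_comm]

lemma pairGen_conjTranspose {c : ℂ} (hc : star c = -c) (v : Fin (2 ^ n) → ℂ) :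
    (pairGen c v)ᴴ = -pairGen c v := by
  rw [pairGen, conjTranspose_smul, conjTranspose_sub, conjTranspose_vecMulVec_self,
    conjTranspose_vecMulVec_self, star_div₀, star_dotProduct_self, hc,
    neg_div, neg_smul]

lemma theta_pairGen {c : ℂ} (hc : star c = -c) (v : Fin (2 ^ n) → ℂ) :
    theta n (pairGen c v) = pairGen c v := by
  rw [pairGen, theta_smul, map_sub, ← theta_vecMulVec, theta_theta, star_div₀,
    star_dotProduct_self, hc, neg_div, neg_smul, ← smul_neg, neg_sub]

lemma pairGen_mulVec (c : ℂ) (v u : Fin (2 ^ n) → ℂ) :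
    pairGen c v *ᵥ u = (c / (star v ⬝ᵥ v)) •
      ((star v ⬝ᵥ u) • v - (star (conjS v) ⬝ᵥ u) • conjS v) := by
  rw [pairGen, smul_mulVec, sub_mulVec, vecMulVec_mulVec, vecMulVec_mulVec, op_smul_eq_smul,
    op_smul_eq_smul]

lemma mul_pairGen {X : Op n} (c : ℂ) {v : Fin (2 ^ n) → ℂ} (h1 : X *ᵥ v = 0)
    (h2 : X *ᵥ conjS v = 0) : X * pairGen c v = 0 := by
  rw [pairGen, mul_smul_comm, mul_sub, mul_vecMulVec, mul_vecMulVec, h1, h2]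
  simp

/-- The isotropy condition `v ⟂ conjS v` is a quadratic equation in `v`, so it has a nonzero
solution in every space of dimension at least two. -/
lemma exists_isotropic {u v : Fin (2 ^ n) → ℂ} (hu : u ≠ 0) (hv : v ≠ 0)
    (huv : star u ⬝ᵥ v = 0) :
    ∃ a b : ℂ, a • u + b • v ≠ 0 ∧
      star (conjS (a • u + b • v)) ⬝ᵥ (a • u + b • v) = 0 := by
  simp only [star_conjS]
  by_cases h0 : v ᵥ* S n ⬝ᵥ v = 0
  · exact ⟨0, 1, by simpa using hv, by simpa using h0⟩
  · obtain ⟨s, hs⟩ := IsAlgClosed.exists_eq_mul_self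
      (discrim (v ᵥ* S n ⬝ᵥ v) (u ᵥ* S n ⬝ᵥ v + v ᵥ* S n ⬝ᵥ u) (u ᵥ* S n ⬝ᵥ u))
    obtain ⟨t, ht⟩ := exists_quadratic_eq_zero h0 ⟨s, hs⟩
    refine ⟨1, t, fun h => ?_, ?_⟩
    · have h1 := congrArg (fun x => star u ⬝ᵥ x) h
      simp only [dotProduct_add, dotProduct_smul, huv, dotProduct_zero, smul_zero, add_zero,
        one_smul] at h1
      exact hu (dotProduct_star_self_eq_zero.1 h1)
    · simp only [add_vecMul, smul_vecMul, dotProduct_add, add_dotProduct, smul_dotProduct,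
        dotProduct_smul, smul_eq_mul]
      linear_combination ht

lemma isotropic_of_odd (hn : Odd n) (v : Fin (2 ^ n) → ℂ) : star (conjS v) ⬝ᵥ v = 0 := by
  have h1 : (S n)ᵀ = -S n := by rw [transpose_S, inv_S, hn.neg_one_pow, neg_one_smul]
  have h2 : v ᵥ* S n ⬝ᵥ v = -(v ᵥ* S n ⬝ᵥ v) := by
    conv_lhs => rw [← dotProduct_mulVec, ← vecMul_transpose, h1, vecMul_neg, dotProduct_neg,
      dotProduct_comm]
  rw [star_conjS]
  linear_combination h2 / 2

end Conjugation

/-! ### Logarithms of `theta`-fixed unitary matrices -/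

section Torus

open scoped ComplexOrder

variable {n : ℕ}

lemma dotProduct_fixed_eq_zero {u v : Fin (2 ^ n) → ℂ} {w : Op n} (hw : w ∈ unitaryGroup _ ℂ)
    {c : ℂ} (hu : w *ᵥ u = u) (hv : w *ᵥ v = c • v) (hc : c ≠ 1) : star v ⬝ᵥ u = 0 :=
  dotProduct_eq_zero_of_eigenvalue_ne hw hv (by rwa [one_smul]) hc

/-- A unitary matrix fixed by `theta`, of determinant one in the case of even `n`, has an
eigenvector `v` with `v ⟂ conjS v` unless it is the identity. For an eigenvalue other than `±1`
this holds since `conjS v` has the conjugate eigenvalue. The eigenvalue `-1` needs a second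
eigenvector, which the determinant provides. -/
lemma exists_isotropic_eigenvector {w : Op n} (hw : w ∈ unitaryGroup (Fin (2 ^ n)) ℂ)
    (hθ : theta n w = w) (hdet : w.det = 1 ∨ Odd n) (h1 : w ≠ 1) :
    ∃ (v : Fin (2 ^ n) → ℂ) (c : ℂ), v ≠ 0 ∧ c ≠ 1 ∧ w *ᵥ v = c • v ∧
      star (conjS v) ⬝ᵥ v = 0 := by
  have key : ∀ (v : Fin (2 ^ n) → ℂ) (c : ℂ), v ≠ 0 → c ≠ 1 → c ≠ -1 → w *ᵥ v = c • v →
      star (conjS v) ⬝ᵥ v = 0 := by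
    intro v c hv hc1 hc2 hwv
    have hJ : w *ᵥ conjS v = star c • conjS v := by rw [mulVec_conjS hθ, hwv, conjS_smul]
    refine dotProduct_eq_zero_of_eigenvalue_ne hw hJ hwv fun h => ?_
    have h2 := star_eigenvalue_mul_self hw hv hwv
    rw [h] at h2
    rcases mul_self_eq_one_iff.1 h2 with h | h
    · exact hc1 h
    · exact hc2 h
  obtain ⟨v, c, hv, hc, hwv⟩ := exists_eigenvector_ne_one hw h1
  rcases hdet with hdet | hodd
  swap
  · exact ⟨v, c, hv, hc, hwv, isotropic_of_odd hodd v⟩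
  by_cases hc' : c ≠ -1
  · exact ⟨v, c, hv, hc, hwv, key v c hv hc hc' hwv⟩
  push Not at hc'
  subst hc'
  -- The reflection in `v` has determinant `-1`, so composing `w` with it does not give the identity.
  set r : ℂ := star v ⬝ᵥ v with hr
  have hr0 : r ≠ 0 := by rwa [hr, Ne, dotProduct_star_self_eq_zero]
  have hrs : star (-2 / r) = -2 / r := by rw [star_div₀, hr, star_dotProduct_self]; simp
  set Q : Op n := 1 + (-2 / r) • vecMulVec v (star v) with hQ
  have hQv : ∀ u, Q *ᵥ u = u + (-2 / r * (star v ⬝ᵥ u)) • v := by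
    intro u
    rw [hQ, add_mulVec, one_mulVec, smul_mulVec, vecMulVec_mulVec, op_smul_eq_smul, smul_smul]
  have hQdet : Q.det = -1 := by
    rw [hQ, ← smul_vecMulVec, vecMulVec_eq Unit, det_one_add_replicateCol_mul_replicateRow,
      dotProduct_smul, ← hr, smul_eq_mul, div_mul_cancel₀ _ hr0]
    norm_num
  have hQu : Q ∈ unitaryGroup (Fin (2 ^ n)) ℂ := by
    have hQH : Qᴴ = Q := by
      rw [hQ, conjTranspose_add, conjTranspose_one, conjTranspose_smul, hrs,
        conjTranspose_vecMulVec_self]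
    rw [mem_unitaryGroup_iff, star_eq_conjTranspose, hQH]
    refine Matrix.ext_of_mulVec_single fun i => ?_
    rw [← mulVec_mulVec, hQv, hQv, one_mulVec, dotProduct_add, dotProduct_smul, ← hr, add_assoc,
      ← add_smul]
    convert! add_zero _
    rw [smul_eq_zero]
    left
    rw [smul_eq_mul, mul_right_comm, div_mul_cancel₀ _ hr0]
    ring
  have hne : w * Q ≠ 1 := by
    intro h
    have := congrArg det h
    rw [det_mul, hdet, hQdet, det_one] at this
    norm_num at this
  obtain ⟨u, d, hu, hd, hwu⟩ := exists_eigenvector_ne_one (mul_mem hw hQu) hne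
  have hvfix : (w * Q) *ᵥ v = (1 : ℂ) • v := by
    rw [← mulVec_mulVec, hQv, ← hr, div_mul_cancel₀ _ hr0, mulVec_add, mulVec_smul, hwv, smul_smul,
      ← add_smul]
    norm_num
  have hvu : star v ⬝ᵥ u = 0 :=
    dotProduct_eq_zero_of_eigenvalue_ne (mul_mem hw hQu) hvfix hwu (Ne.symm hd)
  have hwu' : w *ᵥ u = d • u := by
    rw [← hwu, ← mulVec_mulVec, hQv, hvu, mul_zero, zero_smul, add_zero]
  by_cases hd' : d ≠ -1
  · exact ⟨u, d, hu, hd, hwu', key u d hu hd hd' hwu'⟩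
  push Not at hd'
  subst hd'
  -- The eigenvalue `-1` is at least double, and `v ⟂ conjS v` is solvable in its eigenspace.
  obtain ⟨a, b, hne, hab⟩ := exists_isotropic hv hu hvu
  refine ⟨a • v + b • u, -1, hne, hd, ?_, hab⟩
  rw [mulVec_add, mulVec_smul, mulVec_smul, hwv, hwu', smul_add, smul_comm a, smul_comm b]

/-- The exponential map is onto the group of `theta`-fixed unitary matrices of determinant one, and
for odd `n` the determinant is automatically one. The eigenvalues other than `1` are removed
in conjugate pairs, so that the space of fixed vectors grows. -/
theorem exists_exp_eq_of_theta_eq {w : Op n} (hw : w ∈ unitaryGroup (Fin (2 ^ n)) ℂ)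
    (hθ : theta n w = w) (hdet : w.det = 1 ∨ Odd n) :
    ∃ X ∈ frakK n, exp X = w ∧ ∀ u, w *ᵥ u = u → X *ᵥ u = 0 := by
  induction h : 2 ^ n - Module.finrank ℂ (LinearMap.ker (mulVecLin (w - 1)))
    using Nat.strong_induction_on generalizing w with
  | _ m ih =>
  by_cases h1 : w = 1
  · exact ⟨0, (frakK n).zero_mem, by rw [exp_zero, h1], by simp⟩
  obtain ⟨v, l, hv, hl, hwv, hiso⟩ := exists_isotropic_eigenvector hw hθ hdet h1
  have hll := star_eigenvalue_mul_self hw hv hwv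
  have hwJ : w *ᵥ conjS v = star l • conjS v := by rw [mulVec_conjS hθ, hwv, conjS_smul]
  have hl' : star l ≠ 1 := by
    intro h; apply hl; rw [← star_star l, h, star_one]
  set r : ℂ := star v ⬝ᵥ v with hr
  have hr0 : r ≠ 0 := by rwa [hr, Ne, dotProduct_star_self_eq_zero]
  -- The pair of eigenvectors `v`, `conjS v` becomes fixed after multiplication by `exp (-Y)`.
  set c : ℂ := l.arg * Complex.I with hcdef
  have hc : star c = -c := by simp [hcdef]
  have hexpc : Complex.exp c = l := by
    have hn : ‖l‖ = 1 := by
      have h2 : ‖l‖ * ‖l‖ = 1 := by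
        have := congrArg norm hll
        simpa using this
      nlinarith [norm_nonneg l]
    have := Complex.norm_mul_exp_arg_mul_I l
    rwa [hn, Complex.ofReal_one, one_mul] at this
  set Y := pairGen c v with hY
  have hYH : Yᴴ = -Y := pairGen_conjTranspose hc v
  have hYθ : theta n Y = Y := theta_pairGen hc v
  have hYK : Y ∈ frakK n := mem_frakK_of_skew hYH hYθ
  have hYv : Y *ᵥ v = c • v := by
    rw [hY, pairGen_mulVec, hiso, zero_smul, sub_zero, smul_smul, div_mul_cancel₀ _ hr0]
  have hYJ : Y *ᵥ conjS v = (-c) • conjS v := by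
    have h2 : star v ⬝ᵥ conjS v = 0 := by
      rw [star_dotProduct, hiso, star_zero]
    rw [hY, pairGen_mulVec, star_conjS_dotProduct_conjS, h2, zero_smul, zero_sub, smul_neg,
      smul_smul, div_mul_cancel₀ _ hr0, neg_smul]
  have hYu : ∀ u, w *ᵥ u = u → Y *ᵥ u = 0 := by
    intro u hu
    rw [hY, pairGen_mulVec, dotProduct_fixed_eq_zero hw hu hwv hl,
      dotProduct_fixed_eq_zero hw hu hwJ hl']
    simp
  have hexpl : Complex.exp (-c) = star l := by
    rw [← hc, ← hexpc]
    exact Complex.exp_conj c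
  have hnegH : (-Y)ᴴ = -(-Y) := by rw [conjTranspose_neg, hYH]
  set w' := w * exp (-Y) with hw'
  have hfix : ∀ u, w *ᵥ u = u → w' *ᵥ u = u := by
    intro u hu
    have h2 : (-Y) *ᵥ u = (0 : ℂ) • u := by rw [neg_mulVec, hYu u hu]; simp
    rw [hw', ← mulVec_mulVec, exp_mulVec_of_eigenvector h2, Complex.exp_zero, one_smul, hu]
  have hfixv : w' *ᵥ v = v := by
    have h2 : (-Y) *ᵥ v = (-c) • v := by rw [neg_mulVec, hYv, neg_smul]
    rw [hw', ← mulVec_mulVec, exp_mulVec_of_eigenvector h2, hexpl, mulVec_smul, hwv, smul_smul,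
      hll, one_smul]
  have hfixJ : w' *ᵥ conjS v = conjS v := by
    have h2 : (-Y) *ᵥ conjS v = c • conjS v := by rw [neg_mulVec, hYJ, neg_smul, neg_neg]
    rw [hw', ← mulVec_mulVec, exp_mulVec_of_eigenvector h2, hexpc, mulVec_smul, hwJ, smul_smul,
      mul_comm, hll, one_smul]
  have hθ' : theta n w' = w' := by rw [hw', theta_mul, hθ, theta_exp, map_neg, hYθ]
  have hdet' : w'.det = 1 ∨ Odd n := by
    refine hdet.imp_left fun hd => ?_
    rw [hw', det_mul, hd, det_exp_of_skew hnegH, trace_neg, (mem_su.1 (mem_frakK.1 hYK).1).2]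
    simp
  have hmem : ∀ (x : Op n) u, u ∈ LinearMap.ker (mulVecLin (x - 1)) ↔ x *ᵥ u = u := by
    intro x u
    rw [LinearMap.mem_ker, mulVecLin_apply, sub_mulVec, one_mulVec, sub_eq_zero]
  have hlt : LinearMap.ker (mulVecLin (w - 1)) < LinearMap.ker (mulVecLin (w' - 1)) := by
    refine lt_of_le_not_ge (fun u hu => (hmem _ _).2 (hfix u ((hmem _ _).1 hu))) fun hle => ?_
    have h2 := (hmem _ _).1 (hle ((hmem _ _).2 hfixv))
    rw [hwv] at h2
    exact hl (smul_left_injective ℂ hv (by simpa using h2))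
  have hfr := Submodule.finrank_lt_finrank_of_lt hlt
  have hfr' : Module.finrank ℂ (LinearMap.ker (mulVecLin (w' - 1))) ≤ 2 ^ n := by
    exact (Submodule.finrank_le _).trans_eq (by rw [Module.finrank_fin_fun])
  obtain ⟨X, hXK, hXexp, hXu⟩ := ih
    (2 ^ n - Module.finrank ℂ (LinearMap.ker (mulVecLin (w' - 1)))) (by omega) (w := w')
    (mul_mem hw (exp_mem_unitaryGroup hnegH)) hθ' hdet' rfl
  have hXH := (mem_su.1 (mem_frakK.1 hXK).1).1
  -- `X` vanishes on the image of `Y`, so that `exp (X + Y) = exp X * exp Y`.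
  have hXY : X * Y = 0 := mul_pairGen c (hXu v hfixv) (hXu _ hfixJ)
  have hYX : Y * X = 0 := by
    have := congrArg conjTranspose hXY
    rwa [conjTranspose_mul, hXH, hYH, neg_mul_neg, conjTranspose_zero] at this
  refine ⟨X + Y, (frakK n).add_mem hXK hYK, ?_, fun u hu => ?_⟩
  · rw [exp_add_of_commute _ _ (hXY.trans hYX.symm), hXexp, hw', mul_assoc,
      ← exp_add_of_commute _ _ (Commute.neg_left (Commute.refl Y)), neg_add_cancel, exp_zero,
      mul_one]
  · rw [add_mulVec, hXu u (hfix u hu), hYu u hu, add_zero]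

/-- The surjectivity of the exponential map turns `K`, defined as an image, into a compact group. -/
lemma mem_K_iff {w : Op n} :
    w ∈ K n ↔ w ∈ specialUnitaryGroup (Fin (2 ^ n)) ℂ ∧ theta n w = w := by
  constructor
  · rintro ⟨X, hX, rfl⟩
    have h := mem_frakK.1 hX
    exact ⟨exp_mem_specialUnitaryGroup h.1, by rw [theta_exp, h.2]⟩
  · rintro ⟨h1, h2⟩
    rw [mem_specialUnitaryGroup_iff] at h1
    obtain ⟨X, hX, hXw, -⟩ := exists_exp_eq_of_theta_eq h1.1 h2 (Or.inl h1.2)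
    exact ⟨X, hX, hXw⟩

lemma det_eq_one_of_odd (hn : Odd n) {w : Op n} (hw : w ∈ unitaryGroup (Fin (2 ^ n)) ℂ)
    (hθ : theta n w = w) : w.det = 1 := by
  obtain ⟨X, hX, rfl, -⟩ := exists_exp_eq_of_theta_eq hw hθ (Or.inr hn)
  exact (mem_specialUnitaryGroup_iff.1 (exp_mem_specialUnitaryGroup (mem_frakK.1 hX).1)).2

end Torus

/-! ### Matrices symmetric under reversal of the basis -/

section SymmetricAlgebra

variable {n : ℕ}

/-- The smaller of the two labels `j` and `N - 1 - j`. -/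
def half (j : Fin (2 ^ n)) : Fin (2 ^ n) := min j j.rev

lemma half_rev (j : Fin (2 ^ n)) : half j.rev = half j := by
  rw [half, half, Fin.rev_rev, min_comm]

lemma half_eq (j : Fin (2 ^ n)) : half j = j ∨ half j = j.rev := min_choice _ _

lemma two_pow_pred (hn : 1 ≤ n) : 2 ^ n = 2 ^ (n - 1) + 2 ^ (n - 1) := by
  obtain ⟨k, rfl⟩ : ∃ k, n = k + 1 := ⟨n - 1, by omega⟩
  rw [Nat.add_sub_cancel, pow_succ]; ring

lemma half_eq_self (hn : 1 ≤ n) {j : Fin (2 ^ n)} (hj : (j : ℕ) < 2 ^ (n - 1)) : half j = j := by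
  have := two_pow_pred hn
  refine min_eq_left ?_
  rw [Fin.le_def, Fin.val_rev]
  omega

lemma half_lt (hn : 1 ≤ n) (j : Fin (2 ^ n)) : (half j : ℕ) < 2 ^ (n - 1) := by
  have := two_pow_pred hn
  have hj := j.isLt
  rcases le_total j j.rev with h | h
  · rw [half, min_eq_left h]
    rw [Fin.le_def, Fin.val_rev] at h
    omega
  · rw [half, min_eq_right h, Fin.val_rev]
    rw [Fin.le_def, Fin.val_rev] at h
    omega

lemma rev_ne (hn : 1 ≤ n) (j : Fin (2 ^ n)) : j.rev ≠ j := by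
  have := two_pow_pred hn
  have hj := j.isLt
  intro h
  have h := congrArg Fin.val h
  rw [Fin.val_rev] at h
  omega

lemma eq_or_eq_rev_of_half_eq {j k : Fin (2 ^ n)} (h : half j = half k) : j = k ∨ j = k.rev := by
  rcases half_eq j with h1 | h1 <;> rcases half_eq k with h2 | h2 <;> rw [h1, h2] at h
  · exact Or.inl h
  · exact Or.inr h
  · right; rw [← h, Fin.rev_rev]
  · left; simpa using h

/-- The permutation matrix of `j ↦ N - 1 - j`. -/
def revMatrix (n : ℕ) : Op n := Matrix.of fun a b => if a = b.rev then 1 else 0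

lemma revMatrix_mul_self : revMatrix n * revMatrix n = 1 := by
  ext a b
  simp [revMatrix, Matrix.mul_apply, Matrix.one_apply]

lemma revMatrix_mul_diagonal {f : Fin (2 ^ n) → ℂ} (hf : ∀ j, f j.rev = f j) :
    revMatrix n * diagonal f = diagonal f * revMatrix n := by
  ext a b
  rw [mul_diagonal, diagonal_mul]
  by_cases h : a = b.rev
  · subst h; simp [revMatrix, hf]
  · simp [revMatrix, h]

/-- The commutative algebra of the matrices with equal diagonal entries at `j` and `N - 1 - j`,
equal antidiagonal entries there, and no other entries. On the span of `|j⟩` and `|N - 1 - j⟩`, for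
`j < N / 2`, the eigenvalues of `symMatrix (a, b)` are `a j` and `b j`; the other values of `a` and
`b` play no role. -/
noncomputable def symMatrix (n : ℕ) :
    (Fin (2 ^ n) → ℂ) × (Fin (2 ^ n) → ℂ) →ₐ[ℂ] Op n where
  toFun x := diagonal (fun j => (x.1 (half j) + x.2 (half j)) / 2) +
    diagonal (fun j => (x.1 (half j) - x.2 (half j)) / 2) * revMatrix n
  map_one' := by simp
  map_zero' := by simp
  map_add' x y := by
    rw [add_add_add_comm, diagonal_add, ← add_mul, diagonal_add]
    congr 2
    · funext; simp; ring
    · congr 1; funext; simp; ring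
  map_mul' x y := by
    set p := fun j => (x.1 (half j) + x.2 (half j)) / 2 with hp
    set q := fun j => (x.1 (half j) - x.2 (half j)) / 2 with hq
    set p' := fun j => (y.1 (half j) + y.2 (half j)) / 2 with hp'
    set q' := fun j => (y.1 (half j) - y.2 (half j)) / 2 with hq'
    have h1 : revMatrix n * diagonal p' = diagonal p' * revMatrix n :=
      revMatrix_mul_diagonal fun j => by simp only [hp', half_rev]
    have h2 : revMatrix n * diagonal q' = diagonal q' * revMatrix n :=
      revMatrix_mul_diagonal fun j => by simp only [hq', half_rev]
    have h3 : (diagonal p + diagonal q * revMatrix n) * (diagonal p' + diagonal q' * revMatrix n)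
        = (diagonal p * diagonal p' + diagonal q * diagonal q')
          + (diagonal p * diagonal q' + diagonal q * diagonal p') * revMatrix n := by
      have h4 : diagonal q * revMatrix n * (diagonal q' * revMatrix n)
          = diagonal q * diagonal q' := by
        rw [mul_assoc, ← mul_assoc (revMatrix n), h2, mul_assoc, revMatrix_mul_self, mul_one]
      rw [add_mul, mul_add, mul_add, h4, mul_assoc _ (revMatrix n), h1]
      simp only [add_mul, mul_assoc]
      abel
    rw [h3]
    simp only [diagonal_mul_diagonal, diagonal_add]
    congr 2
    · funext; simp [hp, hq, hp', hq']; ring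
    · congr 1; funext; simp [hp, hq, hp', hq']; ring
  commutes' c := by
    ext a b
    by_cases h : a = b
    · subst h; simp [algebraMap_matrix_apply, Pi.algebraMap_apply]
    · simp [h, algebraMap_matrix_apply, Pi.algebraMap_apply]

lemma symMatrix_eq (x : (Fin (2 ^ n) → ℂ) × (Fin (2 ^ n) → ℂ)) :
    symMatrix n x = diagonal (fun j => (x.1 (half j) + x.2 (half j)) / 2) +
      diagonal (fun j => (x.1 (half j) - x.2 (half j)) / 2) * revMatrix n := rfl

lemma symMatrix_apply (x : (Fin (2 ^ n) → ℂ) × (Fin (2 ^ n) → ℂ)) (j k : Fin (2 ^ n)) :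
    symMatrix n x j k = (if j = k then (x.1 (half j) + x.2 (half j)) / 2 else 0) +
      if j = k.rev then (x.1 (half j) - x.2 (half j)) / 2 else 0 := by
  rw [symMatrix_eq, Matrix.add_apply, diagonal_mul, diagonal_apply]
  simp [revMatrix]

lemma symMatrix_congr {x y : (Fin (2 ^ n) → ℂ) × (Fin (2 ^ n) → ℂ)}
    (h : ∀ j, x.1 (half j) = y.1 (half j) ∧ x.2 (half j) = y.2 (half j)) :
    symMatrix n x = symMatrix n y := by
  ext j k
  rw [symMatrix_apply, symMatrix_apply, (h j).1, (h j).2]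

lemma symMatrix_mul_apply (x : (Fin (2 ^ n) → ℂ) × (Fin (2 ^ n) → ℂ)) (X : Op n)
    (j k : Fin (2 ^ n)) :
    (symMatrix n x * X) j k = (x.1 (half j) + x.2 (half j)) / 2 * X j k +
      (x.1 (half j) - x.2 (half j)) / 2 * X j.rev k := by
  have h : (revMatrix n * X) j k = X j.rev k := by
    rw [Matrix.mul_apply, Finset.sum_eq_single j.rev]
    · simp [revMatrix]
    · intro b _ hb
      have : j ≠ b.rev := by rintro rfl; simp at hb
      simp [revMatrix, this]
    · simp
  rw [symMatrix_eq, add_mul, Matrix.add_apply, mul_assoc, diagonal_mul, diagonal_mul, h]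

lemma mul_symMatrix_apply (x : (Fin (2 ^ n) → ℂ) × (Fin (2 ^ n) → ℂ)) (X : Op n)
    (j k : Fin (2 ^ n)) :
    (X * symMatrix n x) j k = X j k * ((x.1 (half k) + x.2 (half k)) / 2) +
      X j k.rev * ((x.1 (half k) - x.2 (half k)) / 2) := by
  rw [symMatrix_eq, ← revMatrix_mul_diagonal fun j => by simp only [half_rev], mul_add,
    Matrix.add_apply, ← mul_assoc, mul_diagonal, mul_diagonal]
  simp [revMatrix, Matrix.mul_apply]

lemma symMatrix_conjTranspose (x : (Fin (2 ^ n) → ℂ) × (Fin (2 ^ n) → ℂ)) :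
    (symMatrix n x)ᴴ = symMatrix n (star x) := by
  have h : (revMatrix n)ᴴ = revMatrix n := by
    ext a b
    have : b = a.rev ↔ a = b.rev := by
      constructor <;> rintro rfl <;> simp
    simp [revMatrix, this]
  rw [symMatrix_eq, symMatrix_eq, conjTranspose_add, conjTranspose_mul, h,
    diagonal_conjTranspose, diagonal_conjTranspose, revMatrix_mul_diagonal]
  · congr 2
    · ext j; simp
    · congr 1; ext j; simp
  · intro j; simp [half_rev]

lemma tau_symMatrix (x : (Fin (2 ^ n) → ℂ) × (Fin (2 ^ n) → ℂ)) (h : Even n ∨ x.1 = x.2) :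
    tau n (symMatrix n x) = symMatrix n x := by
  rw [tau_eq_self_iff]
  intro a b
  simp only [symMatrix_apply, half_rev, Fin.rev_inj]
  have h1 : b.rev = a ↔ a.rev = b := by constructor <;> rintro rfl <;> simp
  have h2 : (if b = a then signS b * ((x.1 (half b) - x.2 (half b)) / 2) else 0) =
      if a = b then signS a.rev * ((x.1 (half a) - x.2 (half a)) / 2) else 0 := by
    by_cases hab : a = b
    · subst hab
      rcases h with h | h
      · simp [signS_rev, h.neg_one_pow]
      · simp [h]
    · simp [hab, Ne.symm hab]
  have h3 : (if b.rev = a then signS b * ((x.1 (half b) + x.2 (half b)) / 2) else 0) =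
      if a.rev = b then signS a.rev * ((x.1 (half a) + x.2 (half a)) / 2) else 0 := by
    by_cases hab : a.rev = b
    · subst hab; simp [half_rev]
    · simp [hab, h1]
  rw [mul_add, mul_add, mul_ite, mul_zero, mul_ite, mul_zero, mul_ite, mul_zero, mul_ite, mul_zero,
    h2, h3]

section Exponential

attribute [local instance] Matrix.linftyOpNormedRing Matrix.linftyOpNormedAlgebra

lemma exp_symMatrix (x : (Fin (2 ^ n) → ℂ) × (Fin (2 ^ n) → ℂ)) :
    exp (symMatrix n x) =
      symMatrix n (fun j => Complex.exp (x.1 j), fun j => Complex.exp (x.2 j)) := by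
  have h := map_exp (symMatrix n) (symMatrix n).toLinearMap.continuous_of_finiteDimensional x
  refine h.symm.trans ?_
  congr 1
  ext j
  · rw [Prod.fst_exp, Pi.coe_exp, Complex.exp_eq_exp_ℂ]
  · rw [Prod.snd_exp, Pi.coe_exp, Complex.exp_eq_exp_ℂ]

end Exponential

/-- A Hermitian matrix whose centralizer among the `tau`-fixed matrices lies in the range
of `symMatrix`. The antidiagonal entries, which separate `|j⟩` and `|N - 1 - j⟩`, are
present only for even `n`. The factor `3` keeps the eigenvalues `3 j ± 1`, respectively `3 j`, of
different pairs of labels apart. -/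
noncomputable def regular (n : ℕ) : Op n :=
  symMatrix n (fun j => 3 * (j : ℕ) + if Even n then 1 else 0,
    fun j => 3 * (j : ℕ) - if Even n then 1 else 0)

lemma tau_regular : tau n (regular n) = regular n := by
  refine tau_symMatrix _ ?_
  by_cases h : Even n
  · exact Or.inl h
  · right; simp [h]

lemma regular_conjTranspose : (regular n)ᴴ = regular n := by
  rw [regular, symMatrix_conjTranspose]
  congr 1
  ext j
  · simp only [Prod.fst_star, Pi.star_apply]
    split_ifs <;> simp
  · simp only [Prod.snd_star, Pi.star_apply]
    split_ifs <;> simp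

lemma symMatrix_commute_regular (x : (Fin (2 ^ n) → ℂ) × (Fin (2 ^ n) → ℂ)) :
    Commute (symMatrix n x) (regular n) := by
  rw [Commute, SemiconjBy, regular, ← map_mul, ← map_mul, mul_comm]

lemma exists_symMatrix_of_commute (hn : 1 ≤ n) {X : Op n} (hτ : tau n X = X)
    (hX : Commute X (regular n)) :
    ∃ x, X = symMatrix n x ∧ (Odd n → x.1 = x.2) := by
  rw [tau_eq_self_iff] at hτ
  set e : ℂ := if Even n then 1 else 0 with he
  have hent : ∀ j k, (3 * ((half j : ℕ) : ℂ) - 3 * ((half k : ℕ) : ℂ)) * X j k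
      + e * (X j.rev k - X j k.rev) = 0 := by
    intro j k
    have h := congrFun (congrFun hX.eq j) k
    rw [regular, symMatrix_mul_apply, mul_symMatrix_apply] at h
    simp only [← he] at h
    linear_combination -h
  have hzero : ∀ j k, half j ≠ half k → X j k = 0 := by
    intro j k hjk
    -- The four equations at `(j, k)` and its reflections form a linear system of determinant
    -- `δ² (δ² - 4 e²)`, where `δ = 3 t` is a nonzero multiple of `3` and `e` is `0` or `1`.
    have h1 := hent j k
    have h2 := hent j.rev k
    have h3 := hent j k.rev
    have h4 := hent j.rev k.rev
    simp only [half_rev, Fin.rev_rev] at h2 h3 h4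
    set t : ℤ := (half j : ℕ) - (half k : ℕ) with ht
    have ht0 : t ≠ 0 := by
      intro h
      apply hjk
      ext
      omega
    have hd : (3 * ((half j : ℕ) : ℂ) - 3 * ((half k : ℕ) : ℂ)) = 3 * (t : ℂ) := by
      rw [ht]; push_cast; ring
    rw [hd] at h1 h2 h3 h4
    have ht1 : (3 * (t : ℂ)) ≠ 0 := by
      simpa using ht0
    have h5 : X j k + X j.rev k.rev = 0 := by
      apply mul_left_cancel₀ ht1
      linear_combination h1 + h4
    have h6 : X j.rev k + X j k.rev = 0 := by
      apply mul_left_cancel₀ ht1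
      linear_combination h2 + h3
    have h7 : (9 * (t : ℂ) ^ 2 - 4 * e ^ 2) * X j k = 0 := by
      linear_combination 3 * (t : ℂ) * h1 - 2 * e * h2 + 3 * t * e * h6 - 2 * e ^ 2 * h5
    refine (mul_eq_zero.1 h7).resolve_left fun h8 => ?_
    have h9 : (9 * t ^ 2 : ℤ) = 4 ∨ (9 * t ^ 2 : ℤ) = 0 := by
      rw [he] at h8
      split_ifs at h8
      · left
        have : ((9 * t ^ 2 : ℤ) : ℂ) = (4 : ℤ) := by push_cast; linear_combination h8
        exact_mod_cast this
      · right
        have : ((9 * t ^ 2 : ℤ) : ℂ) = (0 : ℤ) := by push_cast; linear_combination h8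
        exact_mod_cast this
    rcases h9 with h9 | h9
    · omega
    · exact ht0 (by simpa using h9)
  have hdiag : ∀ a, X a a = X a.rev a.rev := by
    intro a
    have := hτ a a.rev
    rw [Fin.rev_rev] at this
    exact mul_left_cancel₀ (signS_ne_zero _) this
  have hodd : Odd n → ∀ a, X a.rev a = 0 := by
    intro ho a
    have := hτ a a
    rw [signS_rev, ho.neg_one_pow] at this
    apply mul_left_cancel₀ (signS_ne_zero a)
    linear_combination this / 2
  have hanti : ∀ a, X a a.rev = X a.rev a := by
    intro a
    rcases Nat.even_or_odd n with h | h
    · have := hent a a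
      rw [sub_self, zero_mul, zero_add, he, if_pos h] at this
      linear_combination -this
    · rw [hodd h a]
      simpa using hodd h a.rev
  have hodd' : Odd n → ∀ a, X a a.rev = 0 := fun ho a => by rw [hanti, hodd ho]
  refine ⟨(fun j => X j j + X j j.rev, fun j => X j j - X j j.rev), ?_, fun ho => ?_⟩
  · have hd : ∀ j, X (half j) (half j) = X j j := by
      intro j
      rcases half_eq j with h | h <;> rw [h]
      exact (hdiag j).symm
    have ha : ∀ j, X (half j) (half j).rev = X j j.rev := by
      intro j
      rcases half_eq j with h | h <;> rw [h]
      rw [Fin.rev_rev, hanti]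
    ext j k
    rw [symMatrix_apply]
    simp only [hd, ha]
    by_cases h : half j = half k
    · rcases eq_or_eq_rev_of_half_eq h with rfl | rfl
      · rw [if_pos rfl, if_neg (rev_ne hn j).symm]; ring
      · rw [if_pos rfl, if_neg (rev_ne hn k), Fin.rev_rev]; ring
    · rw [hzero j k h, if_neg, if_neg, add_zero]
      · rintro rfl; exact h (half_rev k)
      · rintro rfl; exact h rfl
  · funext j
    simp [hodd' ho]

end SymmetricAlgebra

/-! ### The subalgebra `𝔞` as a centralizer -/

section CartanSubalgebra

variable {n : ℕ}

/-- The matrix `i|j⟩⟨j| + i|N-j-1⟩⟨N-j-1|`. -/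
noncomputable def diagPair (j : Fin (2 ^ n)) : Op n :=
  Matrix.single j j Complex.I + Matrix.single j.rev j.rev Complex.I

/-- The matrix `i|j⟩⟨N-j-1| + i|N-j-1⟩⟨j|`. -/
noncomputable def antidiagPair (j : Fin (2 ^ n)) : Op n :=
  Matrix.single j j.rev Complex.I + Matrix.single j.rev j Complex.I

lemma symMatrix_single (hn : 1 ≤ n) {j : Fin (2 ^ n)} (hj : (j : ℕ) < 2 ^ (n - 1)) (p q : ℂ) :
    symMatrix n (Pi.single j (p + q), Pi.single j (p - q)) =
      Matrix.single j j p + Matrix.single j.rev j.rev p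
        + (Matrix.single j j.rev q + Matrix.single j.rev j q) := by
  have hjj := half_eq_self hn hj
  have hr := rev_ne hn j
  ext a b
  have hab : half a = j ↔ a = j ∨ a = j.rev := by
    constructor
    · intro h
      rw [← hjj] at h
      exact eq_or_eq_rev_of_half_eq h
    · rintro (rfl | rfl)
      · exact hjj
      · rw [half_rev, hjj]
  rw [symMatrix_apply]
  simp only [Pi.single_apply, hab, Matrix.add_apply, Matrix.single_apply]
  by_cases h1 : a = j
  · subst h1
    have h2 : a = b.rev ↔ a.rev = b := by constructor <;> rintro rfl <;> simp
    simp [h2, hr]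
  · by_cases h2 : a = j.rev
    · subst h2
      have h3 : j = b ↔ j.rev = b.rev := by simp
      simp [h1, hr.symm]
    · simp [h1, h2, Ne.symm h1, Ne.symm h2]

lemma diagPair_eq (hn : 1 ≤ n) {j : Fin (2 ^ n)} (hj : (j : ℕ) < 2 ^ (n - 1)) :
    diagPair j = symMatrix n (Pi.single j Complex.I, Pi.single j Complex.I) := by
  have := symMatrix_single hn hj Complex.I 0
  simp only [add_zero, sub_zero, single_zero] at this
  rw [this, diagPair]

lemma antidiagPair_eq (hn : 1 ≤ n) {j : Fin (2 ^ n)} (hj : (j : ℕ) < 2 ^ (n - 1)) :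
    antidiagPair j = symMatrix n (Pi.single j Complex.I, Pi.single j (-Complex.I)) := by
  have := symMatrix_single hn hj 0 Complex.I
  simp only [zero_add, zero_sub, single_zero] at this
  rw [this, antidiagPair]

lemma trace_diagPair (j : Fin (2 ^ n)) : (diagPair j).trace = 2 * Complex.I := by
  simp [diagPair, two_mul]

lemma trace_antidiagPair (hn : 1 ≤ n) (j : Fin (2 ^ n)) : (antidiagPair j).trace = 0 := by
  rw [antidiagPair, trace_add, trace_single_eq_of_ne _ _ _ (rev_ne hn j).symm,
    trace_single_eq_of_ne _ _ _ (rev_ne hn j), add_zero]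

lemma mem_diagGens {X : Op n} : X ∈ diagGens n ↔ ∃ j k : Fin (2 ^ n), (k : ℕ) = (j : ℕ) + 1 ∧
    (k : ℕ) < 2 ^ (n - 1) ∧ X = diagPair j - diagPair k := by
  simp only [diagGens, diagPair, Set.mem_ofPred_eq, sub_add_eq_sub_sub]

lemma star_single_I (j : Fin (2 ^ n)) :
    star (Pi.single j Complex.I : Fin (2 ^ n) → ℂ) = -Pi.single j Complex.I := by
  funext k
  by_cases h : k = j
  · subst h; simp
  · simp [h]

lemma symMatrix_mem_frakP {x : (Fin (2 ^ n) → ℂ) × (Fin (2 ^ n) → ℂ)} (h1 : star x = -x)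
    (h2 : (symMatrix n x).trace = 0) (h3 : Even n ∨ x.1 = x.2) : symMatrix n x ∈ frakP n := by
  rw [mem_frakP_iff, symMatrix_conjTranspose, h1, map_neg]
  exact ⟨rfl, h2, tau_symMatrix x h3⟩

lemma diagGens_subset (hn : 1 ≤ n) {X : Op n} (hX : X ∈ diagGens n) :
    X ∈ frakP n ∧ Commute X (regular n) := by
  obtain ⟨j, k, hjk, hk, rfl⟩ := mem_diagGens.1 hX
  have ht : (diagPair j - diagPair k).trace = 0 := by
    rw [trace_sub, trace_diagPair, trace_diagPair, sub_self]
  rw [diagPair_eq hn (by omega : (j : ℕ) < _), diagPair_eq hn hk, ← map_sub] at *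
  refine ⟨symMatrix_mem_frakP ?_ ht (Or.inr rfl), symMatrix_commute_regular _⟩
  simp only [star_sub, Prod.star_def, star_single_I, Prod.neg_mk, Prod.mk_sub_mk, neg_sub]
  congr 1 <;> abel

lemma antidiagGens_subset (hn : 1 ≤ n) (he : Even n) {X : Op n} (hX : X ∈ antidiagGens n) :
    X ∈ frakP n ∧ Commute X (regular n) := by
  obtain ⟨j, hj, rfl⟩ := hX
  change antidiagPair j ∈ _ ∧ Commute (antidiagPair j) _
  have ht := trace_antidiagPair hn j
  rw [antidiagPair_eq hn hj] at *
  refine ⟨symMatrix_mem_frakP ?_ ht (Or.inl he), symMatrix_commute_regular _⟩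
  simp only [Prod.star_def, star_single_I, Prod.neg_mk, Pi.single_neg, star_neg]

/-- The matrices in `𝔭` commuting with `regular n`. -/
def regularCentralizer (n : ℕ) : Submodule ℝ (Op n) where
  carrier := {X | X ∈ frakP n ∧ Commute X (regular n)}
  zero_mem' := ⟨(frakP n).zero_mem, Commute.zero_left _⟩
  add_mem' h1 h2 := ⟨(frakP n).add_mem h1.1 h2.1, h1.2.add_left h2.2⟩
  smul_mem' r _ h := ⟨(frakP n).smul_mem r h.1, h.2.smul_left r⟩

lemma frakA_le (hn : 1 ≤ n) : frakA n ≤ regularCentralizer n := by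
  unfold frakA
  split_ifs with h
  · rw [Submodule.span_le]
    rintro X (hX | hX)
    · exact diagGens_subset hn hX
    · exact antidiagGens_subset hn h hX
  · rw [Submodule.span_le]
    exact fun X hX => diagGens_subset hn hX

lemma diagGens_subset_frakA : diagGens n ⊆ frakA n := by
  unfold frakA
  split_ifs with h
  · exact fun X hX => Submodule.subset_span (Or.inl hX)
  · exact Submodule.subset_span

lemma diagPair_sub_mem {j : Fin (2 ^ n)} (hj : (j : ℕ) < 2 ^ (n - 1)) :
    diagPair j - diagPair (⟨0, by positivity⟩ : Fin (2 ^ n)) ∈ frakA n := by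
  obtain ⟨j, hj'⟩ := j
  induction j with
  | zero => simp
  | succ j ih =>
    have hj0 : j < 2 ^ n := by omega
    have h1 := ih hj0 (by simp only at hj ⊢; omega)
    have h2 : diagPair (⟨j, hj0⟩ : Fin (2 ^ n)) - diagPair ⟨j + 1, hj'⟩ ∈ frakA n :=
      diagGens_subset_frakA (mem_diagGens.2 ⟨_, _, rfl, hj, rfl⟩)
    have h3 := (frakA n).sub_mem h1 h2
    convert! h3 using 1
    abel

/-- A skew-Hermitian matrix in the range of `symMatrix` is a real combination of the matrices
`diagPair j` and `antidiagPair j`; summation by parts then uses that the trace vanishes. -/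
lemma symMatrix_mem_frakA (hn : 1 ≤ n) {x : (Fin (2 ^ n) → ℂ) × (Fin (2 ^ n) → ℂ)}
    (h1 : (symMatrix n x)ᴴ = -symMatrix n x) (h2 : (symMatrix n x).trace = 0)
    (h3 : Odd n → x.1 = x.2) : symMatrix n x ∈ frakA n := by
  set p : Fin (2 ^ n) → ℂ := fun j => (x.1 j + x.2 j) / 2 with hp
  set q : Fin (2 ^ n) → ℂ := fun j => (x.1 j - x.2 j) / 2 with hq
  set s : Finset (Fin (2 ^ n)) := Finset.univ.filter fun j => (j : ℕ) < 2 ^ (n - 1) with hs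
  have hmem : ∀ j, j ∈ s ↔ (j : ℕ) < 2 ^ (n - 1) := fun j => by simp [hs]
  have hre : ∀ j ∈ s, (p j).re = 0 ∧ (q j).re = 0 := by
    intro j hj
    have hjj := half_eq_self hn ((hmem j).1 hj)
    have e1 := congrFun (congrFun h1 j) j
    have e2 := congrFun (congrFun h1 j.rev) j
    rw [conjTranspose_apply, Matrix.neg_apply, symMatrix_apply, if_pos rfl,
      if_neg (rev_ne hn j).symm, hjj, add_zero] at e1
    rw [conjTranspose_apply, Matrix.neg_apply, symMatrix_apply, symMatrix_apply,
      if_neg (rev_ne hn j).symm, if_neg (rev_ne hn j), Fin.rev_rev, if_pos rfl, if_pos rfl,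
      half_rev, hjj, zero_add] at e2
    have f1 := congrArg Complex.re e1
    have f2 := congrArg Complex.re e2
    simp only [Complex.star_def, Complex.conj_re, Complex.neg_re] at f1 f2
    exact ⟨by simp only [hp]; linarith, by simp only [hq]; linarith⟩
  have hsum : symMatrix n x = ∑ j ∈ s, ((p j).im • diagPair j + (q j).im • antidiagPair j) := by
    have e1 : symMatrix n x = symMatrix n (∑ j ∈ s, (Pi.single j (x.1 j), Pi.single j (x.2 j))) := by
      refine symMatrix_congr fun k => ?_
      have hk := (hmem (half k)).2 (half_lt hn k)
      rw [Prod.fst_sum, Prod.snd_sum, Finset.sum_apply, Finset.sum_apply]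
      simp only [Finset.sum_pi_single, hk, if_true]
      trivial
    rw [e1, map_sum]
    refine Finset.sum_congr rfl fun j hj => ?_
    have hj' := (hmem j).1 hj
    have e2 : x.1 j = p j + q j := by simp only [hp, hq]; ring
    have e3 : x.2 j = p j - q j := by simp only [hp, hq]; ring
    have e4 : p j = (p j).im • Complex.I := by
      apply Complex.ext <;> simp [(hre j hj).1]
    have e5 : q j = (q j).im • Complex.I := by
      apply Complex.ext <;> simp [(hre j hj).2]
    rw [e2, e3, symMatrix_single hn hj', diagPair, antidiagPair, smul_add, smul_add, smul_single,
      smul_single, smul_single, smul_single, ← e4, ← e5]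
  have htr : ∑ j ∈ s, (p j).im = 0 := by
    rw [hsum, trace_sum] at h2
    simp only [trace_add, trace_smul, trace_diagPair, trace_antidiagPair hn, smul_zero,
      add_zero] at h2
    rw [← Finset.sum_smul] at h2
    have h4 : ((∑ j ∈ s, (p j).im : ℝ) : ℂ) = 0 := by simpa using h2
    exact_mod_cast h4
  have hsum' : symMatrix n x = ∑ j ∈ s, ((p j).im •
      (diagPair j - diagPair (⟨0, by positivity⟩ : Fin (2 ^ n))) + (q j).im • antidiagPair j) := by
    simp only [smul_sub, sub_add_eq_add_sub, Finset.sum_sub_distrib]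
    rw [← Finset.sum_smul, htr, zero_smul, sub_zero, hsum]
  rw [hsum']
  refine Submodule.sum_mem _ fun j hj => ?_
  have hj' := (hmem j).1 hj
  refine Submodule.add_mem _ (Submodule.smul_mem _ _ (diagPair_sub_mem hj')) ?_
  rcases Nat.even_or_odd n with he | ho
  · refine Submodule.smul_mem _ _ ?_
    rw [frakA, if_pos he]
    exact Submodule.subset_span (Or.inr ⟨j, hj', rfl⟩)
  · have : q j = 0 := by simp only [hq, h3 ho]; simp
    rw [this, Complex.zero_im, zero_smul]
    exact Submodule.zero_mem _

lemma mem_frakA_iff (hn : 1 ≤ n) {X : Op n} :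
    X ∈ frakA n ↔ X ∈ frakP n ∧ Commute X (regular n) := by
  refine ⟨fun h => frakA_le hn h, fun ⟨h1, h2⟩ => ?_⟩
  rw [mem_frakP_iff] at h1
  obtain ⟨x, rfl, hx⟩ := exists_symMatrix_of_commute hn h1.2.2 h2
  exact symMatrix_mem_frakA hn h1.1 h1.2.1 hx

lemma lie_eq_zero_of_mem_frakA (hn : 1 ≤ n) {X Y : Op n} (hX : X ∈ frakA n) (hY : Y ∈ frakA n) :
    ⁅X, Y⁆ = 0 := by
  rw [mem_frakA_iff hn, mem_frakP_iff] at hX hY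
  obtain ⟨x, rfl, -⟩ := exists_symMatrix_of_commute hn hX.1.2.2 hX.2
  obtain ⟨y, rfl, -⟩ := exists_symMatrix_of_commute hn hY.1.2.2 hY.2
  rw [Ring.lie_def, ← map_mul, ← map_mul, mul_comm, sub_self]

/-- Up to a scalar matrix and the factor `i`, `regular n` lies in `𝔞`; this makes `𝔞` its
own centralizer in `𝔭`. -/
lemma frakA_maximal (hn : 1 ≤ n) {𝔟 : Submodule ℝ (Op n)} (h1 : frakA n ≤ 𝔟) (h2 : 𝔟 ≤ frakP n)
    (h3 : ∀ X ∈ 𝔟, ∀ Y ∈ 𝔟, ⁅X, Y⁆ = 0) : 𝔟 = frakA n := by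
  refine le_antisymm (fun X hX => (mem_frakA_iff hn).2 ⟨h2 hX, ?_⟩) h1
  set t : ℂ := (regular n).trace / 2 ^ n with ht
  have hN : (2 : ℂ) ^ n ≠ 0 := by simp
  have hst : star (regular n).trace = (regular n).trace := by
    rw [← trace_conjTranspose, regular_conjTranspose]
  have hst' : star t = t := by
    rw [ht, star_div₀, hst]; simp
  set Y : Op n := Complex.I • (regular n - t • 1) with hY
  have hYA : Y ∈ frakA n := by
    rw [mem_frakA_iff hn, mem_frakP_iff]
    refine ⟨⟨?_, ?_, ?_⟩, ?_⟩
    · rw [hY, conjTranspose_smul, conjTranspose_sub, regular_conjTranspose, conjTranspose_smul,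
        hst', conjTranspose_one, Complex.star_def, Complex.conj_I, neg_smul]
    · rw [hY, trace_smul, trace_sub, trace_smul, trace_one, ht, Fintype.card_fin]
      simp
    · rw [hY, tau_smul, tau_sub, tau_regular, tau_smul, tau_one]
    · exact (Commute.sub_left (Commute.refl _) ((Commute.one_left _).smul_left _)).smul_left _
  have h4 : Commute X Y := by
    have := h3 X hX Y (h1 hYA)
    rwa [Ring.lie_def, sub_eq_zero] at this
  have h5 : regular n = (-Complex.I) • Y + t • 1 := by
    rw [hY, smul_smul]; simp
  rw [h5]
  exact (h4.smul_right _).add_right ((Commute.one_right _).smul_right _)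

end CartanSubalgebra

/-! ### Conjugation into the centralizer -/

section Optimization

variable {n : ℕ}

lemma isCompact_K (n : ℕ) : IsCompact (K n) := by
  have hsub : K n ⊆ Set.univ.pi fun _ : Fin (2 ^ n) =>
      Set.univ.pi fun _ : Fin (2 ^ n) => Metric.closedBall (0 : ℂ) 1 := by
    intro w hw i _ j _
    rw [mem_closedBall_zero_iff]
    exact entry_norm_bound_of_unitary (mem_specialUnitaryGroup_iff.1 (mem_K_iff.1 hw).1).1 i j
  refine IsCompact.of_isClosed_subset (isCompact_univ_pi fun _ => isCompact_univ_pi fun _ =>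
    isCompact_closedBall _ _) ?_ hsub
  have h : K n = {w : Op n | w * wᴴ = 1} ∩ {w | w.det = 1} ∩ {w | theta n w = w} := by
    ext w
    rw [mem_K_iff, mem_specialUnitaryGroup_iff, mem_unitaryGroup_iff]
    rfl
  rw [h]
  refine ((isClosed_eq ?_ continuous_const).inter (isClosed_eq ?_ continuous_const)).inter
    (isClosed_eq (continuous_theta n) continuous_id)
  · exact continuous_id.matrix_mul continuous_id.matrix_conjTranspose
  · exact continuous_id.matrix_det

lemma mul_mem_K {v w : Op n} (hv : v ∈ K n) (hw : w ∈ K n) : v * w ∈ K n := by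
  rw [mem_K_iff] at *
  exact ⟨mul_mem hv.1 hw.1, by rw [theta_mul, hv.2, hw.2]⟩

lemma one_mem_K : (1 : Op n) ∈ K n := mem_K_iff.2 ⟨one_mem _, theta_one n⟩

/-- The trace form is negative definite on skew-Hermitian matrices. -/
lemma eq_zero_of_re_trace_mul_self {C : Op n} (h1 : Cᴴ = -C) (h2 : (C * C).trace.re = 0) :
    C = 0 := by
  have h3 : C * C = -(Cᴴ * C) := by rw [h1, neg_mul, neg_neg]
  rw [h3, trace_neg, Complex.neg_re, neg_eq_zero, Matrix.trace, Complex.re_sum] at h2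
  have h4 : ∀ j, ((Cᴴ * C).diag j).re = ∑ i, Complex.normSq (C i j) := by
    intro j
    rw [diag_apply, Matrix.mul_apply, Complex.re_sum]
    refine Finset.sum_congr rfl fun i _ => ?_
    rw [conjTranspose_apply, Complex.star_def, mul_comm, Complex.mul_conj, Complex.ofReal_re]
  simp only [h4] at h2
  ext i j
  have h5 := (Finset.sum_eq_zero_iff_of_nonneg fun j _ =>
    Finset.sum_nonneg fun i _ => Complex.normSq_nonneg (C i j)).1 h2 j (Finset.mem_univ j)
  have h6 := (Finset.sum_eq_zero_iff_of_nonneg fun i _ =>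
    Complex.normSq_nonneg (C i j)).1 h5 i (Finset.mem_univ i)
  exact Complex.normSq_eq_zero.1 h6

section Derivative

attribute [local instance] Matrix.linftyOpNormedRing Matrix.linftyOpNormedAlgebra

/-- The derivative at the identity of a trace function along a conjugation orbit. -/
lemma hasDerivAt_trace_conj (X Z H : Op n) :
    HasDerivAt (fun t : ℝ => (exp (t • (-X)) * Z * exp (t • X) * H).trace.re)
      ((Z * X - X * Z) * H).trace.re 0 := by
  have h1 := hasDerivAt_exp_smul_const (𝕂 := ℝ) (-X) 0
  have h2 := hasDerivAt_exp_smul_const (𝕂 := ℝ) X 0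
  have h3 := ((h1.mul_const Z).mul h2).mul_const H
  let F : Op n →ₗ[ℝ] ℝ := Complex.reLm ∘ₗ traceLinearMap (Fin (2 ^ n)) ℝ ℂ
  have h4 := (F.toContinuousLinearMap.hasFDerivAt).comp_hasDerivAt (0 : ℝ) h3
  convert! h4 using 1
  simp only [zero_smul, exp_zero, one_mul, mul_one, neg_mul, sub_eq_neg_add]
  rfl

end Derivative

/-- Conjugation by `K` moves every matrix `Z` of the `-1`-eigenspace of `theta` into the
centralizer of `regular n`. At a maximum of `k ↦ Re tr (kᴴ Z k (i H))`, where `H` is `regular n`, the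
commutator of `kᴴ Z k` and `i H` is orthogonal to `𝔨`, and it is itself an element of `𝔨`. -/
theorem exists_conj_commute_regular {Z : Op n} (hZ : Zᴴ = -Z) (hτ : tau n Z = Z) :
    ∃ k ∈ K n, Commute (kᴴ * Z * k) (regular n) := by
  set H : Op n := Complex.I • regular n with hH
  have hHH : Hᴴ = -H := by rw [hH, conjTranspose_smul, regular_conjTranspose]; simp
  have hHτ : tau n H = H := by rw [hH, tau_smul, tau_regular]
  obtain ⟨k, hk, hmax⟩ := (isCompact_K n).exists_isMaxOn ⟨1, one_mem_K⟩
    (f := fun k : Op n => (kᴴ * Z * k * H).trace.re) (by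
      refine Continuous.continuousOn (Complex.continuous_re.comp (Continuous.matrix_trace ?_))
      exact ((continuous_id.matrix_conjTranspose.matrix_mul continuous_const).matrix_mul
        continuous_id).matrix_mul continuous_const)
  refine ⟨k, hk, ?_⟩
  obtain ⟨W, hW⟩ : ∃ W, W = kᴴ * Z * k := ⟨_, rfl⟩
  rw [← hW]
  have hWH : Wᴴ = -W := by
    rw [hW, conjTranspose_mul, conjTranspose_mul, conjTranspose_conjTranspose, hZ]
    simp [mul_assoc]
  have hkτ : tau n k = kᴴ := tau_eq_conjTranspose (mem_K_iff.1 hk).2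
  have hkτ' : tau n kᴴ = k := by rw [← theta_eq, (mem_K_iff.1 hk).2]
  have hWτ : tau n W = W := by rw [hW, tau_mul, tau_mul, hτ, hkτ, hkτ', mul_assoc]
  obtain ⟨C, hC⟩ : ∃ C, C = W * H - H * W := ⟨_, rfl⟩
  have hCH : Cᴴ = -C := by
    rw [hC, conjTranspose_sub, conjTranspose_mul, conjTranspose_mul, hHH, hWH]
    simp
  have hCτ : theta n C = C := by
    rw [theta_eq, hCH, tau_neg, hC, tau_sub, tau_mul, tau_mul, hWτ, hHτ, neg_sub]
  have hCK : C ∈ frakK n := mem_frakK_of_skew hCH hCτ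
  have hder := hasDerivAt_trace_conj C W H
  have hloc : IsLocalMax
      (fun t : ℝ => (exp (t • (-C)) * W * exp (t • C) * H).trace.re) 0 := by
    refine Filter.Eventually.of_forall fun t => ?_
    have ht : k * exp (t • C) ∈ K n := mul_mem_K hk ⟨_, (frakK n).smul_mem t hCK, rfl⟩
    have h1 := hmax ht
    have h2 : (exp (t • C))ᴴ = exp (t • (-C)) := by
      rw [← exp_conjTranspose, conjTranspose_smul, hCH, star_trivial]
    simp only [Set.mem_ofPred_eq, conjTranspose_mul, h2] at h1
    simp only [zero_smul, exp_zero, one_mul, mul_one]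
    convert! h1 using 3 <;> simp only [hW, mul_assoc]
  have hzero := hloc.hasDerivAt_eq_zero hder
  have hCC : (C * C).trace.re = 0 := by
    have : (C * C).trace = -((W * C - C * W) * H).trace := by
      have e1 : (W * C * H).trace = (C * (H * W)).trace := by
        rw [mul_assoc, trace_mul_comm, mul_assoc]
      nth_rewrite 2 [hC]
      rw [sub_mul, trace_sub, e1, mul_sub, trace_sub, mul_assoc C W H]
      ring
    rw [this, Complex.neg_re, hzero, neg_zero]
  have hC0 := eq_zero_of_re_trace_mul_self hCH hCC
  have h3 : Commute W H := sub_eq_zero.1 (hC ▸ hC0)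
  have h4 : regular n = (-Complex.I) • H := by rw [hH, smul_smul]; simp
  rw [h4]
  exact h3.smul_right _

end Optimization

/-! ### Unitary matrices fixed by `tau` -/

section Decomposition

variable {n : ℕ}

/-- Conjugation by `K` also moves `tau`-fixed unitary matrices into the centralizer of `regular n`.
The Cayley transform replaces a unitary `M` by a skew-Hermitian matrix; the phase `c` keeps the
eigenvalues of `c M` away from `-1`. -/
theorem exists_conj_commute_regular_of_unitary {M : Op n}
    (hM : M ∈ unitaryGroup (Fin (2 ^ n)) ℂ) (hτ : tau n M = M) :
    ∃ k ∈ K n, Commute (kᴴ * M * k) (regular n) := by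
  obtain ⟨c, hc, hcu⟩ : ∃ c : ℂ, star c * c = 1 ∧ IsUnit (c • 1 + M) := by
    have hfin : (spectrum ℂ (-M)).Finite := Matrix.finite_spectrum _
    have hinf : (Metric.sphere (0 : ℂ) 1).Infinite := by
      -- The points `e ^ (i k)` for natural `k` are distinct, as `π` is irrational.
      have h1 : Function.Injective fun k : ℕ => Complex.exp (k * Complex.I) := by
        intro a b hab
        obtain ⟨m, hm⟩ := Complex.exp_eq_exp_iff_exists_int.1 hab
        have h2 : (a : ℂ) - b = m * (2 * Real.pi) := by
          apply mul_right_cancel₀ Complex.I_ne_zero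
          linear_combination hm
        have h3 : ((a : ℤ) - b : ℤ) = (m : ℝ) * (2 * Real.pi) := by
          push_cast
          exact_mod_cast h2
        by_cases hm0 : m = 0
        · subst hm0
          have : (a : ℝ) = b := by
            have h4 : (a : ℝ) - b = 0 := by simpa using h3
            linarith
          exact_mod_cast this
        · exfalso
          have : Irrational (((m * 2 : ℤ) : ℝ) * Real.pi) :=
            irrational_pi.intCast_mul (by omega)
          refine this ⟨((a : ℤ) - b : ℤ), ?_⟩
          push_cast at h3 ⊢
          linarith
      refine (Set.infinite_range_of_injective h1).mono ?_
      rintro _ ⟨k, rfl⟩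
      simp only [mem_sphere_iff_norm, sub_zero]
      exact_mod_cast Complex.norm_exp_ofReal_mul_I k
    obtain ⟨c, hc1, hc2⟩ := (hinf.sdiff hfin).nonempty
    refine ⟨c, ?_, ?_⟩
    · rw [mem_sphere_iff_norm, sub_zero] at hc1
      rw [Complex.star_def, mul_comm, Complex.mul_conj, Complex.normSq_eq_norm_sq, hc1]
      simp
    · rw [spectrum.mem_iff, not_not, sub_neg_eq_add, Algebra.algebraMap_eq_smul_one] at hc2
      exact hc2
  obtain ⟨B, hB⟩ : ∃ B, B = c • 1 + M := ⟨_, rfl⟩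
  rw [← hB] at hcu
  have hBdet : IsUnit B.det := (Matrix.isUnit_iff_isUnit_det _).1 hcu
  have hBi : B * B⁻¹ = 1 := Matrix.mul_nonsing_inv _ hBdet
  have hiB : B⁻¹ * B = 1 := Matrix.nonsing_inv_mul _ hBdet
  have hτB : tau n B = B := by rw [hB, tau_add, tau_smul, tau_one, hτ]
  have hτi : tau n B⁻¹ = B⁻¹ := by
    have h1 := congrArg (tau n) hBi
    rw [tau_mul, hτB, tau_one] at h1
    exact (Matrix.inv_eq_left_inv h1).symm
  obtain ⟨W, hW⟩ : ∃ W, W = c • B⁻¹ := ⟨_, rfl⟩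
  have hτW : tau n W = W := by rw [hW, tau_smul, hτi]
  -- `W = c (c + M)⁻¹` has real part `1 / 2`.
  have hWW : W + Wᴴ = 1 := by
    have h1 : W * B = c • 1 := by rw [hW, smul_mul_assoc, hiB]
    have h2 : Bᴴ * Wᴴ = star c • 1 := by
      rw [← conjTranspose_mul, h1, conjTranspose_smul, conjTranspose_one]
    have hBH : Bᴴ = star c • 1 + Mᴴ := by
      rw [hB, conjTranspose_add, conjTranspose_smul, conjTranspose_one]
    have h3 : Bᴴ * (W + Wᴴ) * B = Bᴴ * B := by
      have e1 : Bᴴ * (W + Wᴴ) * B = c • Bᴴ + star c • B := by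
        rw [mul_add, add_mul, mul_assoc, h1, h2, mul_smul_comm, mul_one, smul_mul_assoc, one_mul]
      have e2 : Mᴴ * M = 1 := mem_unitaryGroup_iff'.1 hM
      rw [e1, hBH, hB]
      simp only [smul_add, mul_add, add_mul, smul_mul_assoc, mul_smul_comm, mul_one, one_mul,
        smul_smul, e2, hc, mul_comm c, one_smul]
      abel
    have hHi : B⁻¹ᴴ * Bᴴ = 1 := by rw [← conjTranspose_mul, hBi, conjTranspose_one]
    calc W + Wᴴ = (B⁻¹ᴴ * Bᴴ) * (W + Wᴴ) * (B * B⁻¹) := by rw [hHi, hBi, one_mul, mul_one]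
      _ = B⁻¹ᴴ * (Bᴴ * (W + Wᴴ) * B) * B⁻¹ := by simp only [mul_assoc]
      _ = (B⁻¹ᴴ * Bᴴ) * (B * B⁻¹) := by rw [h3]; simp only [mul_assoc]
      _ = 1 := by rw [hHi, hBi, one_mul]
  set Z := W - Wᴴ with hZ
  have hZ' : W = (1 / 2 : ℂ) • (1 + Z) := by
    rw [hZ, ← hWW]; module
  have hZH : Zᴴ = -Z := by rw [hZ, conjTranspose_sub, conjTranspose_conjTranspose, neg_sub]
  have hZτ : tau n Z = Z := by
    rw [hZ, tau_sub, hτW, ← tau_conjTranspose, hτW]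
  obtain ⟨k, hk, hcomm⟩ := exists_conj_commute_regular hZH hZτ
  refine ⟨k, hk, ?_⟩
  have hkk : kᴴ * k = 1 := mem_unitaryGroup_iff'.1
    (mem_specialUnitaryGroup_iff.1 (mem_K_iff.1 hk).1).1
  have hkk' : k * kᴴ = 1 := mul_eq_one_comm.1 hkk
  -- The commutation passes from `Z` to `B⁻¹`, then to its inverse `B`, and to `M`.
  have h1 : Commute (kᴴ * B⁻¹ * k) (regular n) := by
    have hBZ : B⁻¹ = (star c * (1 / 2)) • (1 + Z) := by
      rw [mul_smul, ← hZ', hW, smul_smul, hc, one_smul]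
    have : kᴴ * B⁻¹ * k = (star c * (1 / 2)) • (1 + kᴴ * Z * k) := by
      rw [hBZ, mul_smul_comm, smul_mul_assoc, mul_add, add_mul, mul_one, hkk]
    rw [this]
    exact ((Commute.one_left _).add_left hcomm).smul_left _
  have e1 : kᴴ * B * k * (kᴴ * B⁻¹ * k) = 1 := by
    calc _ = kᴴ * B * (k * kᴴ) * B⁻¹ * k := by simp only [mul_assoc]
      _ = kᴴ * (B * B⁻¹) * k := by rw [hkk', mul_one]; simp only [mul_assoc]
      _ = 1 := by rw [hBi, mul_one, hkk]
  have e2 : kᴴ * B⁻¹ * k * (kᴴ * B * k) = 1 := mul_eq_one_comm.1 e1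
  have h2 : Commute (kᴴ * B * k) (regular n) := by
    let u : (Op n)ˣ := ⟨kᴴ * B⁻¹ * k, kᴴ * B * k, e2, e1⟩
    exact Commute.units_inv_left (u := u) h1
  have h3 : kᴴ * M * k = kᴴ * B * k - c • 1 := by
    rw [hB, mul_add, add_mul, mul_smul_comm, smul_mul_assoc, mul_one, hkk]; abel
  rw [h3]
  exact h2.sub_left ((Commute.one_left _).smul_left _)

/-- Every unitary matrix in the range of `symMatrix` is the square of the exponential
of a skew-Hermitian one. -/
lemma exists_symMatrix_exp (hn : 1 ≤ n) {x : (Fin (2 ^ n) → ℂ) × (Fin (2 ^ n) → ℂ)}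
    (hx : symMatrix n x ∈ unitaryGroup (Fin (2 ^ n)) ℂ) (h : Odd n → x.1 = x.2) :
    ∃ y, star y = -y ∧ (Odd n → y.1 = y.2) ∧
      symMatrix n x = exp (symMatrix n y) * exp (symMatrix n y) := by
  have h1 : symMatrix n (star x * x) = 1 := by
    rw [map_mul, ← symMatrix_conjTranspose]
    exact mem_unitaryGroup_iff'.1 hx
  have hent : ∀ j, star (x.1 (half j)) * x.1 (half j) = 1 ∧
      star (x.2 (half j)) * x.2 (half j) = 1 := by
    intro j
    have e1 := congrFun (congrFun h1 j) j
    have e2 := congrFun (congrFun h1 j) j.rev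
    rw [symMatrix_apply, if_pos rfl, if_neg (rev_ne hn j).symm, one_apply_eq] at e1
    rw [symMatrix_apply, if_neg (rev_ne hn j).symm, Fin.rev_rev, if_pos rfl,
      one_apply_ne (rev_ne hn j).symm] at e2
    simp only [Prod.fst_mul, Prod.snd_mul, Pi.mul_apply, Prod.fst_star, Prod.snd_star,
      Pi.star_apply] at e1 e2
    constructor
    · linear_combination e1 + e2
    · linear_combination e1 - e2
  have hexp : ∀ z : ℂ, star z * z = 1 →
      Complex.exp (z.arg / 2 * Complex.I) * Complex.exp (z.arg / 2 * Complex.I) = z := by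
    intro z hz
    have hn : ‖z‖ = 1 := by
      have h2 : ‖z‖ * ‖z‖ = 1 := by simpa using congrArg norm hz
      nlinarith [norm_nonneg z]
    have h3 := Complex.norm_mul_exp_arg_mul_I z
    rw [hn, Complex.ofReal_one, one_mul] at h3
    rw [← Complex.exp_add]
    nth_rewrite 3 [← h3]
    congr 1
    ring
  refine ⟨(fun j => (x.1 j).arg / 2 * Complex.I, fun j => (x.2 j).arg / 2 * Complex.I), ?_, ?_, ?_⟩
  · ext j <;> simp
  · intro ho
    simp only [h ho]
  · rw [exp_symMatrix, ← map_mul]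
    refine symMatrix_congr fun j => ?_
    simp only [Prod.fst_mul, Prod.snd_mul, Pi.mul_apply]
    exact ⟨(hexp _ (hent j).1).symm, (hexp _ (hent j).2).symm⟩

end Decomposition

/-! ### The decomposition of the special unitary group -/

section Decomposition

variable {n : ℕ}

lemma tau_mem_unitaryGroup {U : Op n} (hU : U ∈ unitaryGroup (Fin (2 ^ n)) ℂ) :
    tau n U ∈ unitaryGroup (Fin (2 ^ n)) ℂ := by
  rw [mem_unitaryGroup_iff, star_eq_conjTranspose, tau_conjTranspose, ← tau_mul,
    ← star_eq_conjTranspose, mem_unitaryGroup_iff'.1 hU, tau_one]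

lemma conjTranspose_mem_specialUnitaryGroup {U : Op n}
    (hU : U ∈ specialUnitaryGroup (Fin (2 ^ n)) ℂ) :
    Uᴴ ∈ specialUnitaryGroup (Fin (2 ^ n)) ℂ := by
  rw [mem_specialUnitaryGroup_iff] at *
  exact ⟨Unitary.star_mem hU.1, by rw [det_conjTranspose, hU.2, star_one]⟩

/-- If `e²` is conjugate under `k` to `U θ(U)⁻¹`, then `k e` is the `exp 𝔭`-part
of `U`: the remaining factor is fixed by `theta`. -/
lemma theta_residual_eq {U k e : Op n} (hU : U ∈ unitaryGroup (Fin (2 ^ n)) ℂ) (hk : k ∈ K n)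
    (he : e ∈ unitaryGroup (Fin (2 ^ n)) ℂ) (heτ : tau n e = e)
    (h : kᴴ * (U * tau n U) * k = e * e) : theta n (eᴴ * kᴴ * U) = eᴴ * kᴴ * U := by
  have hkk : k * kᴴ = 1 := mem_unitaryGroup_iff.1
    (mem_specialUnitaryGroup_iff.1 (mem_K_iff.1 hk).1).1
  have hee : eᴴ * e = 1 := mem_unitaryGroup_iff'.1 he
  have hUU : Uᴴ * U = 1 := mem_unitaryGroup_iff'.1 hU
  have hUτ : tau n U * tau n Uᴴ = 1 := by rw [← tau_mul, hUU, tau_one]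
  have hkτ : tau n k = kᴴ := tau_eq_conjTranspose (mem_K_iff.1 hk).2
  have h1 : kᴴ * U = e * e * kᴴ * tau n Uᴴ := by
    calc kᴴ * U = kᴴ * (U * tau n U) * (k * kᴴ) * tau n Uᴴ := by
          rw [hkk, mul_one, mul_assoc, mul_assoc, hUτ, mul_one]
      _ = _ := by rw [← h]; simp only [mul_assoc]
  rw [theta_eq, conjTranspose_mul, conjTranspose_mul, conjTranspose_conjTranspose,
    conjTranspose_conjTranspose, tau_mul, tau_mul, heτ, hkτ, mul_assoc eᴴ, h1]
  calc e * kᴴ * tau n Uᴴ = (eᴴ * e) * (e * kᴴ * tau n Uᴴ) := by rw [hee, one_mul]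
    _ = _ := by simp only [mul_assoc]

/-- The trace of a logarithm of the middle factor can be removed by a matrix in the kernel of
`X ↦ exp (2 X)`. For odd `n` the diagonal entries come in pairs, which restricts the trace. -/
lemma exists_kernel_element (hn : 1 ≤ n) {t : ℂ} (ht2 : Complex.exp (2 * t) = 1)
    (hodd : Odd n → Complex.exp t = 1) :
    ∃ z, star z = -z ∧ (Odd n → z.1 = z.2) ∧ (symMatrix n z).trace = t ∧
      ∀ j, Complex.exp (z.1 j) * Complex.exp (z.1 j) = 1 ∧
        Complex.exp (z.2 j) * Complex.exp (z.2 j) = 1 := by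
  set o : Fin (2 ^ n) := ⟨0, by positivity⟩ with ho
  have ho' : (o : ℕ) < 2 ^ (n - 1) := by simp [ho]
  have htr : ∀ p q : ℂ, (symMatrix n (Pi.single o (p + q), Pi.single o (p - q))).trace = 2 * p := by
    intro p q
    rw [symMatrix_single hn ho', trace_add, trace_add, trace_add, trace_single_eq_same,
      trace_single_eq_same, trace_single_eq_of_ne _ _ _ (rev_ne hn o).symm,
      trace_single_eq_of_ne _ _ _ (rev_ne hn o)]
    ring
  have hexp : ∀ (c : ℂ), Complex.exp (2 * c) = 1 → ∀ j,
      Complex.exp ((Pi.single o c : Fin (2 ^ n) → ℂ) j) *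
        Complex.exp ((Pi.single o c : Fin (2 ^ n) → ℂ) j) = 1 := by
    intro c hc j
    rw [← Complex.exp_add, ← two_mul]
    by_cases h : j = o
    · subst h; simpa using hc
    · simp [h]
  have hstar : ∀ c : ℂ, star c = -c →
      star (Pi.single o c : Fin (2 ^ n) → ℂ) = -Pi.single o c := by
    intro c hc
    funext j
    by_cases h : j = o
    · subst h; simpa using hc
    · simp [h]
  rcases Nat.even_or_odd n with he | hodd'
  · obtain ⟨m, hm⟩ := Complex.exp_eq_one_iff.1 ht2
    have hst : star t = -t := by
      have h1 : t = m * (Real.pi * Complex.I) := by linear_combination hm / 2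
      rw [h1]; simp
    refine ⟨(Pi.single o t, 0), ?_, fun h => absurd he (Nat.not_even_iff_odd.2 h), ?_,
      fun j => ⟨hexp t ht2 j, by simp⟩⟩
    · rw [Prod.star_def, hstar t hst]; simp
    · have := htr (t / 2) (t / 2)
      rw [add_halves, sub_self, Pi.single_zero] at this
      rw [this]; ring
  · obtain ⟨m, hm⟩ := Complex.exp_eq_one_iff.1 (hodd hodd')
    have hst : star (t / 2) = -(t / 2) := by
      have h1 : t / 2 = m * (Real.pi * Complex.I) := by linear_combination hm / 2
      rw [h1]; simp
    have ht' : Complex.exp (2 * (t / 2)) = 1 := by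
      rw [mul_div_cancel₀ _ two_ne_zero]; exact hodd hodd'
    refine ⟨(Pi.single o (t / 2), Pi.single o (t / 2)), ?_, fun _ => rfl, ?_,
      fun j => ⟨hexp _ ht' j, hexp _ ht' j⟩⟩
    · rw [Prod.star_def, hstar _ hst]; rfl
    · have := htr (t / 2) 0
      rw [add_zero, sub_zero] at this
      rw [this]; ring

/-- The nontrivial half of the decomposition: the middle factor is a square root `e = exp Y`, with
`Y ∈ 𝔞`, of a conjugate of `U θ(U)⁻¹` by an element of `K`. -/
theorem specialUnitaryGroup_subset (hn : 1 ≤ n) :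
    (specialUnitaryGroup (Fin (2 ^ n)) ℂ : Set (Op n)) ⊆ K n * A n * K n := by
  intro U hUS
  obtain ⟨hU, hUdet⟩ := mem_specialUnitaryGroup_iff.1 hUS
  have hMτ : tau n (U * tau n U) = U * tau n U := by rw [tau_mul, tau_tau]
  obtain ⟨k, hk, hcomm⟩ :=
    exists_conj_commute_regular_of_unitary (mul_mem hU (tau_mem_unitaryGroup hU)) hMτ
  obtain ⟨hkS, hkθ⟩ := mem_K_iff.1 hk
  obtain ⟨hkU, hkdet⟩ := mem_specialUnitaryGroup_iff.1 hkS
  have hkk : k * kᴴ = 1 := mem_unitaryGroup_iff.1 hkU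
  have hkHdet : kᴴ.det = 1 := by rw [det_conjTranspose, hkdet, star_one]
  have hkτ' : tau n kᴴ = k := by rw [← theta_eq, hkθ]
  have hkτ : tau n k = kᴴ := tau_eq_conjTranspose hkθ
  have hM'τ : tau n (kᴴ * (U * tau n U) * k) = kᴴ * (U * tau n U) * k := by
    rw [tau_mul, tau_mul, hMτ, hkτ, hkτ']
    simp only [mul_assoc]
  obtain ⟨x, hx, hxo⟩ := exists_symMatrix_of_commute hn hM'τ hcomm
  have hxu : symMatrix n x ∈ unitaryGroup (Fin (2 ^ n)) ℂ := by
    rw [← hx]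
    exact mul_mem (mul_mem (Unitary.star_mem hkU) (mul_mem hU (tau_mem_unitaryGroup hU))) hkU
  obtain ⟨y, hy, hyo, hxy⟩ := exists_symMatrix_exp hn hxu hxo
  have hskew : ∀ y, star y = -y → (symMatrix n y)ᴴ = -symMatrix n y := fun y hy => by
    rw [symMatrix_conjTranspose, hy, map_neg]
  have hτexp : ∀ y : (Fin (2 ^ n) → ℂ) × (Fin (2 ^ n) → ℂ), (Odd n → y.1 = y.2) →
      tau n (exp (symMatrix n y)) = exp (symMatrix n y) := fun y hy => by
    rw [exp_symMatrix]
    refine tau_symMatrix _ ((Nat.even_or_odd n).imp_right fun ho => ?_)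
    simp only [hy ho]
  have hedet := det_exp_of_skew (hskew y hy)
  have ht2 : Complex.exp (2 * (symMatrix n y).trace) = 1 := by
    have h1 := congrArg det (hx.trans hxy)
    rw [det_mul, det_mul, det_mul, det_tau, hUdet, hkdet, hkHdet, det_mul, hedet,
      ← Complex.exp_add, ← two_mul] at h1
    simpa using h1.symm
  -- For odd `n` the residual factor is fixed by `theta`, so it has determinant one.
  have hodd : Odd n → Complex.exp (symMatrix n y).trace = 1 := by
    intro ho
    have hfix := theta_residual_eq hU hk (exp_mem_unitaryGroup (hskew y hy)) (hτexp y hyo)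
      (hx.trans hxy)
    have h1 := det_eq_one_of_odd ho (mul_mem (mul_mem
      (Unitary.star_mem (exp_mem_unitaryGroup (hskew y hy))) (Unitary.star_mem hkU)) hU) hfix
    rw [det_mul, det_mul, star_eq_conjTranspose, star_eq_conjTranspose, hkHdet, hUdet,
      det_conjTranspose, hedet, mul_one, mul_one] at h1
    rw [← star_star (Complex.exp _), h1, star_one]
  obtain ⟨z, hz, hzo, hzt, hz1⟩ := exists_kernel_element hn ht2 hodd
  have hd : star (y - z) = -(y - z) := by rw [star_sub, hy, hz]; abel
  have hdo : Odd n → (y - z).1 = (y - z).2 := fun ho => by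
    rw [Prod.fst_sub, Prod.snd_sub, hyo ho, hzo ho]
  have hdx : symMatrix n x = exp (symMatrix n (y - z)) * exp (symMatrix n (y - z)) := by
    rw [hxy, exp_symMatrix, exp_symMatrix, ← map_mul, ← map_mul]
    refine symMatrix_congr fun j => ?_
    have key : ∀ a b : ℂ, Complex.exp b * Complex.exp b = 1 →
        Complex.exp a * Complex.exp a = Complex.exp (a - b) * Complex.exp (a - b) := by
      intro a b hb
      have : a = (a - b) + b := by ring
      nth_rewrite 1 2 [this]
      rw [Complex.exp_add]
      linear_combination (Complex.exp (a - b)) ^ 2 * hb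
    exact ⟨key _ _ (hz1 _).1, key _ _ (hz1 _).2⟩
  have hdA : symMatrix n (y - z) ∈ frakA n := by
    refine symMatrix_mem_frakA hn (hskew _ hd) ?_ hdo
    rw [map_sub, trace_sub, hzt, sub_self]
  set e := exp (symMatrix n (y - z)) with he
  have heS : e ∈ specialUnitaryGroup (Fin (2 ^ n)) ℂ :=
    exp_mem_specialUnitaryGroup (mem_frakP.1 ((mem_frakA_iff hn).1 hdA).1).1
  have heU := (mem_specialUnitaryGroup_iff.1 heS).1
  have hfix := theta_residual_eq hU hk heU (hτexp _ hdo) (hx.trans hdx)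
  refine Set.mem_mul.2 ⟨k * e, Set.mul_mem_mul hk ⟨_, hdA, rfl⟩, eᴴ * kᴴ * U,
    mem_K_iff.2 ⟨mul_mem (mul_mem (conjTranspose_mem_specialUnitaryGroup heS)
      (conjTranspose_mem_specialUnitaryGroup hkS)) hUS, hfix⟩, ?_⟩
  have hee : e * eᴴ = 1 := mem_unitaryGroup_iff.1 heU
  calc k * e * (eᴴ * kᴴ * U) = k * (e * eᴴ) * kᴴ * U := by simp only [mul_assoc]
    _ = U := by rw [hee, mul_one, hkk, one_mul]

theorem specialUnitaryGroup_eq (hn : 1 ≤ n) :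
    (specialUnitaryGroup (Fin (2 ^ n)) ℂ : Set (Op n)) = K n * A n * K n := by
  refine (specialUnitaryGroup_subset hn).antisymm ?_
  rintro _ ⟨_, ⟨k, hk, _, ⟨X, hX, rfl⟩, rfl⟩, l, hl, rfl⟩
  exact mul_mem (mul_mem (mem_K_iff.1 hk).1 (exp_mem_specialUnitaryGroup
    (mem_frakP.1 ((mem_frakA_iff hn).1 hX).1).1)) (mem_K_iff.1 hl).1

end Decomposition

lemma theta_eq_smul {n : ℕ} (X : Op n) :
    theta n X = (-1 : ℂ) ^ n • (S n * X.map (starRingEnd ℂ) * S n) := by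
  change (S n)⁻¹ * X.map (starRingEnd ℂ) * S n = _
  rw [inv_S, smul_mul_assoc, smul_mul_assoc]

end CCD

theorem mainTheorem3 (n : ℕ) (hn : 1 ≤ n) :
    -- `theta` is well defined on `su(2^n)`, and its two descriptions agree
    IsUnit (CCD.S n) ∧
    (∀ X : CCD.Op n,
      CCD.theta n X = (-1 : ℂ) ^ n • (CCD.S n * X.map (starRingEnd ℂ) * CCD.S n)) ∧
    (∀ X ∈ CCD.su n, CCD.theta n X ∈ CCD.su n) ∧
    -- `theta` is a Cartan involution of `su(2^n)`, with its eigenspace decomposition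
    (∀ X ∈ CCD.su n, CCD.theta n (CCD.theta n X) = X) ∧
    (∀ X ∈ CCD.su n, ∀ Y ∈ CCD.su n,
      CCD.theta n ⁅X, Y⁆ = ⁅CCD.theta n X, CCD.theta n Y⁆) ∧
    (CCD.frakK n ⊓ CCD.frakP n = ⊥ ∧ CCD.frakK n ⊔ CCD.frakP n = CCD.su n) ∧
    -- `𝔞` is contained in `𝔭`, commutative, and maximal with these two properties
    CCD.frakA n ≤ CCD.frakP n ∧
    (∀ X ∈ CCD.frakA n, ∀ Y ∈ CCD.frakA n, ⁅X, Y⁆ = 0) ∧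
    (∀ 𝔟 : Submodule ℝ (CCD.Op n), CCD.frakA n ≤ 𝔟 → 𝔟 ≤ CCD.frakP n →
      (∀ X ∈ 𝔟, ∀ Y ∈ 𝔟, ⁅X, Y⁆ = 0) → 𝔟 = CCD.frakA n) ∧
    -- `SU(2^n) = K A K`
    (Matrix.specialUnitaryGroup (Fin (2 ^ n)) ℂ : Set (CCD.Op n)) =
      CCD.K n * CCD.A n * CCD.K n := by
  exact ⟨CCD.isUnit_S n, CCD.theta_eq_smul, fun X hX => CCD.theta_mem_su hX,
    fun X _ => CCD.theta_theta X, fun X _ Y _ => CCD.theta_lie X Y,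
    ⟨CCD.frakK_inf_frakP n, CCD.frakK_sup_frakP n⟩,
    fun X hX => ((CCD.mem_frakA_iff hn).1 hX).1,
    fun X hX Y hY => CCD.lie_eq_zero_of_mem_frakA hn hX hY,
    fun 𝔟 h1 h2 h3 => CCD.frakA_maximal hn h1 h2 h3, CCD.specialUnitaryGroup_eq hn⟩
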